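/- Let $k\ge 2$ and let $\mathscr F=\{f_1,\dots,f_k\}$ be a family of $C^1$-diffeomorphisms of the circle $\mathbb S^1$ (orientation-preserving or not). Let $\langle\mathscr F\rangle^+$ be the semigroup of all compositions of one or more of the maps $f_i$, let $\Sigma_k=\{1,\dots,k\}^{\mathbb N}$ (with the product topology) with the one-sided shift $\sigma$, and let $F=\sigma\ltimes\mathscr F$ be the skew-product $F(\omega,x)=(\sigma(\omega),f_{\omega_0}(x))$ on $\Sigma_k\times\mathbb S^1$. Assume that (i) $\mathscr F$ is minimal: for every $x\in\mathbb S^1$ the orbit $\{f(x): f\in\langle\mathscr F\rangle^+\}$ is dense in $\mathbb S^1$; (ii) $\mathscr F$ is backward expanding: for every $x\in\mathbb S^1$ there is $f\in\langle\mathscr F\rangle^+$ with $|f'(x)|>1$; (iii) some $f\in\langle\mathscr F\rangle^+$ has a hyperbolic attracting periodic point, i.e. there are $x\in\mathbb S^1$ and $n\ge1$ with $f^n(x)=x$ and $|(f^n)'(x)|<1$. Then there is an ergodic $F$-invariant Borel probability measure $\mu$ on $\Sigma_k\times\mathbb S^1$ whose topological support is all of $\Sigma_k\times\mathbb S^1$,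 which is the weak$^*$ limit of a sequence of measures each of which is uniformly distributed on a periodic orbit of $F$, and whose fibre Lyapunov exponent $$\lambda(\mu)=\int \log|(f_{\omega_0})'(x)|\,d\mu(\omega,x)$$ (the integral of an integrable function) is equal to $0$. -/

import Mathlib

open MeasureTheory Filter Topology
open scoped Manifold ENNReal

/-- The type of `C¹`-diffeomorphisms of the unit circle `𝕊¹ ⊂ ℂ`
(no assumption on the orientation). -/
abbrev CircleDiffeo : Type := Diffeomorph (𝓡 1) (𝓡 1) Circle Circle 1

/-- The absolute value `|g'(x)|` of the derivative of a circle map `g` at `x` with respect to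
arc length: the speed at `t = 0` of the curve `t ↦ g (x e^{it})`. -/
noncomputable def circleAbsDeriv (g : Circle → Circle) (x : Circle) : ℝ :=
  ‖deriv (fun t : ℝ => ((g (x * Circle.exp t) : Circle) : ℂ)) 0‖

/-- The semigroup `⟨f₁, …, f_k⟩⁺` of all compositions of one or more of the maps `f i`, inside the
monoid (under composition) of all self-maps of the circle. -/
def iteratedSemigroup {k : ℕ} (f : Fin k → CircleDiffeo) : Subsemigroup (Function.End Circle) :=
  Subsemigroup.closure (Set.range fun i : Fin k => (⇑(f i) : Circle → Circle))

/-- The family is minimal: every orbit of the semigroup is dense in the circle. -/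
def IsMinimalFamily {k : ℕ} (f : Fin k → CircleDiffeo) : Prop :=
  ∀ x : Circle, Dense {y : Circle | ∃ g : Circle → Circle, g ∈ iteratedSemigroup f ∧ g x = y}

/-- The family is backward expanding: at every point some element of the semigroup has derivative
of absolute value larger than one. -/
def IsBackwardExpanding {k : ℕ} (f : Fin k → CircleDiffeo) : Prop :=
  ∀ x : Circle, ∃ g : Circle → Circle, g ∈ iteratedSemigroup f ∧ 1 < circleAbsDeriv g x

/-- The map `g` has a hyperbolic attracting periodic point: `gⁿ(x) = x` and `|(gⁿ)'(x)| < 1` for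
some `x` and some `n ≥ 1`. -/
def HasHyperbolicAttractingPeriodicPt (g : Circle → Circle) : Prop :=
  ∃ (x : Circle) (n : ℕ), 0 < n ∧ Function.IsPeriodicPt g n x ∧ circleAbsDeriv (g^[n]) x < 1

/-- The phase space `Σ_k × 𝕊¹`, where `Σ_k = {1, …, k}^ℕ` carries the product topology. -/
abbrev SkewSpace (k : ℕ) : Type := (ℕ → Fin k) × Circle

/-- The circle carries its Borel σ-algebra. -/
noncomputable instance circleMeasurableSpace : MeasurableSpace Circle := borel Circle

instance circleBorelSpace : BorelSpace Circle := ⟨rfl⟩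

/-- The locally constant skew product `F (ω, x) = (σ ω, f_{ω₀} x)` over the one-sided shift `σ`. -/
noncomputable def skewProduct {k : ℕ} (f : Fin k → CircleDiffeo) (p : SkewSpace k) : SkewSpace k :=
  (fun n => p.1 (n + 1), f (p.1 0) p.2)

/-- The function `(ω, x) ↦ log |(f_{ω₀})'(x)|`. -/
noncomputable def fibreLogDeriv {k : ℕ} (f : Fin k → CircleDiffeo) (p : SkewSpace k) : ℝ :=
  Real.log (circleAbsDeriv (f (p.1 0)) p.2)

/-- The fibre Lyapunov exponent `λ(μ) = ∫ log |(f_{ω₀})'(x)| dμ(ω, x)`. -/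
noncomputable def fibreLyapunovExponent {k : ℕ} (f : Fin k → CircleDiffeo)
    (μ : Measure (SkewSpace k)) : ℝ :=
  ∫ p, fibreLogDeriv f p ∂μ

/-- The measure uniformly distributed on the orbit of a periodic point `p` of `G`. -/
noncomputable def periodicOrbitMeasure {X : Type*} [MeasurableSpace X] (G : X → X) (p : X) :
    Measure X :=
  ((Function.minimalPeriod G p : ℝ≥0∞)⁻¹) •
    ∑ i ∈ Finset.range (Function.minimalPeriod G p), Measure.dirac (G^[i] p)

/-! The measure is obtained as a limit of measures on periodic orbits whose exponents are negative
and tend to `0`, each orbit following the previous one most of the time.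

Improvement step (`exists_periodic_orbit_with_smaller_exponent`). Let a periodic orbit have exponent
`-Λ < 0`. Repeat it `N` times, then apply a word that expands enough to cancel about half of the
accumulated contraction, then a word of bounded length that visits a prescribed open set and returns
close to the starting point. Compactness turns backward expansion and minimality into statements
with uniform constants, so the expanding word has length at most a constant times the contraction to
be cancelled, and the last word is negligible when `N` is large. The whole composition still
contracts strongly near the starting point and almost fixes it, hence has a true fixed point nearby
(`exists_fixedPoint_fibreMap`). The new exponent is negative and at most `3/4` of the old one in
absolute value, while the proportion of time not spent near the old orbit is `O(Λ)`.

Iteration (`HasCheapImprovement.exists_sequence`). The exponents decay geometrically, so the losses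
are summable and a lower bound with enough slack for the mean of a test function survives forever.
Two kinds of bounds are recorded. A function positive on an open set just visited keeps a positive
mean, which gives full support. If `n` is a period of the current orbit and `c` the mean of `h` on
it, then `1 - |A_n h - c|`, where `A_n` is the average over `n` steps, equals `1` on the orbit and
keeps a mean close to `1` later. In the limit, `A_n h` is close to a constant in `L¹` for a dense
set of `h`, which forces ergodicity (`ergodic_of_concentration`). The logarithm of the derivative is
continuous, so the limit exponent is `0`. -/

/-! ### Metric calculus of circle diffeomorphisms -/

/-- The lift of a circle map to a `ℂ`-valued function on the line. -/
noncomputable def circleLift (g : Circle → Circle) (s : ℝ) : ℂ := (g (Circle.exp s) : ℂ)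

lemma contDiff_circleLift (g : CircleDiffeo) : ContDiff ℝ 1 (circleLift g) := by
  have h1 : ContMDiff 𝓘(ℝ, ℝ) (𝓡 1) 1 (fun s : ℝ => g (Circle.exp s)) :=
    g.contMDiff_toFun.comp contMDiff_circleExp
  have h2 : ContMDiff (𝓡 1) 𝓘(ℝ, ℂ) 1 (fun z : Circle => (z : ℂ)) := by
    have : Fact (Module.finrank ℝ ℂ = 1 + 1) := ⟨Complex.finrank_real_complex⟩
    exact contMDiff_coe_sphere
  exact contMDiff_iff_contDiff.1 (h2.comp h1)

lemma circleAbsDeriv_exp (g : Circle → Circle) (s : ℝ) :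
    circleAbsDeriv g (Circle.exp s) = ‖deriv (circleLift g) s‖ := by
  have h : (fun t : ℝ => ((g (Circle.exp s * Circle.exp t) : Circle) : ℂ)) =
      fun t => circleLift g (s + t) := by
    funext t
    simp [circleLift, Circle.exp_add]
  rw [circleAbsDeriv, h, deriv_comp_const_add]
  simp

lemma circleLift_periodic (g : Circle → Circle) :
    Function.Periodic (circleLift g) (2 * Real.pi) := by
  intro s
  simp [circleLift, Circle.exp_add]

lemma deriv_circleLift_periodic (g : Circle → Circle) :
    Function.Periodic (deriv (circleLift g)) (2 * Real.pi) := by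
  intro s
  have : (fun t => circleLift g (t + 2 * Real.pi)) = circleLift g :=
    funext (circleLift_periodic g)
  rw [← deriv_comp_add_const, this]

/-- A continuous periodic function on the line is uniformly continuous. -/
lemma uniformContinuous_of_periodic {E : Type*} [PseudoMetricSpace E] {h : ℝ → E} {c : ℝ}
    (hc : 0 < c) (hp : Function.Periodic h c) (hh : Continuous h) :
    ∀ ε > 0, ∃ δ > 0, ∀ s t, |s - t| < δ → dist (h s) (h t) < ε := by
  intro ε hε
  have huc : UniformContinuousOn h (Set.Icc (-1) (c + 1)) :=
    isCompact_Icc.uniformContinuousOn_of_continuous hh.continuousOn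
  obtain ⟨δ, hδ, H⟩ := Metric.uniformContinuousOn_iff.1 huc ε hε
  refine ⟨min δ 1, lt_min hδ one_pos, fun s t hst => ?_⟩
  have hst1 : |s - t| < δ := hst.trans_le (min_le_left _ _)
  have hst2 : |s - t| < 1 := hst.trans_le (min_le_right _ _)
  obtain ⟨n, hn, -⟩ := existsUnique_sub_zsmul_mem_Ico hc s 0
  have e1 : h s = h (s - n • c) := (hp.sub_zsmul_eq n).symm
  have e2 : h t = h (t - n • c) := (hp.sub_zsmul_eq n).symm
  rw [e1, e2]
  rw [abs_lt] at hst2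
  refine H _ ⟨?_, ?_⟩ _ ⟨?_, ?_⟩ ?_
  · linarith [hn.1]
  · linarith [hn.2]
  · linarith [hn.1]
  · linarith [hn.2]
  · rw [Real.dist_eq]; simpa using hst1

/-- Mean value inequality for `u ↦ circleLift g u - u * deriv (circleLift g) s`, whose derivative is
small by uniform continuity of the periodic function `deriv (circleLift g)`. -/
lemma circleLift_uniform_diff (g : CircleDiffeo) :
    ∀ ε > 0, ∃ δ > 0, ∀ s t : ℝ, |t| < δ →
      ‖circleLift g (s + t) - circleLift g s - (t : ℂ) * deriv (circleLift g) s‖ ≤ ε * |t| := by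
  intro ε hε
  have hC := contDiff_circleLift g
  have hd : Differentiable ℝ (circleLift g) := hC.differentiable one_ne_zero
  obtain ⟨δ, hδ, H⟩ := uniformContinuous_of_periodic (by positivity)
    (deriv_circleLift_periodic g) (hC.continuous_deriv le_rfl) ε hε
  refine ⟨δ, hδ, fun s t ht => ?_⟩
  have hder : ∀ u ∈ Set.uIcc s (s + t), HasDerivWithinAt
      (fun u : ℝ => circleLift g u - (u : ℂ) * deriv (circleLift g) s)
      (deriv (circleLift g) u - 1 * deriv (circleLift g) s) (Set.uIcc s (s + t)) u := by
    intro u _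
    refine ((hd u).hasDerivAt.sub ?_).hasDerivWithinAt
    exact (Complex.ofRealCLM.hasDerivAt (x := u)).mul_const _
  have hb : ∀ u ∈ Set.uIcc s (s + t),
      ‖deriv (circleLift g) u - 1 * deriv (circleLift g) s‖ ≤ ε := by
    intro u hu
    rw [one_mul, ← dist_eq_norm]
    refine (H _ _ ?_).le
    have := Set.abs_sub_left_of_mem_uIcc hu
    simp only [add_sub_cancel_left] at this
    exact this.trans_lt ht
  have := (convex_uIcc s (s + t)).norm_image_sub_le_of_norm_hasDerivWithin_le hder hb
    Set.left_mem_uIcc Set.right_mem_uIcc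
  simp only [add_sub_cancel_left, Real.norm_eq_abs] at this
  refine le_of_eq_of_le ?_ this
  congr 1
  push_cast
  ring

lemma Circle.dist_eq_norm_sub (x y : Circle) : dist x y = ‖(x : ℂ) - (y : ℂ)‖ := by
  rw [← dist_eq_norm]; rfl

lemma Circle.dist_mul_left_eq (x y z : Circle) : dist (x * y) (x * z) = dist y z := by
  rw [Circle.dist_eq_norm_sub, Circle.dist_eq_norm_sub]
  rw [Circle.coe_mul, Circle.coe_mul, ← mul_sub, norm_mul, Circle.norm_coe, one_mul]

/-- Near every point of the circle, arc length and chord length are comparable. -/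
lemma Circle.exists_exp_of_dist_lt : ∀ ε > 0, ∃ ρ > 0, ∀ x y : Circle, dist x y < ρ →
    ∃ s t : ℝ, x = Circle.exp s ∧ y = Circle.exp (s + t) ∧ |t| < ε ∧
      |(|t|) - dist x y| ≤ ε * |t| := by
  intro ε hε
  have h1 : HasDerivAt (fun t : ℝ => Complex.exp (t * Complex.I)) Complex.I 0 := by
    have := ((Complex.ofRealCLM.hasDerivAt (x := 0)).mul_const Complex.I).cexp
    simpa using this
  have h2 := (hasDerivAt_iff_isLittleO_nhds_zero.1 h1).def hε
  obtain ⟨δ, hδ, H⟩ := Metric.eventually_nhds_iff.1 h2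
  have h3 : ContinuousAt (fun z : Circle => Complex.arg z) 1 := by
    refine ContinuousAt.comp (g := Complex.arg) ?_ continuous_subtype_val.continuousAt
    exact Complex.continuousAt_arg (by simp)
  obtain ⟨ρ, hρ, R⟩ := Metric.continuousAt_iff.1 h3 (min δ ε) (lt_min hδ hε)
  refine ⟨ρ, hρ, fun x y hxy => ⟨Complex.arg x, Complex.arg (x⁻¹ * y : Circle), ?_, ?_, ?_, ?_⟩⟩
  · simp
  · rw [Circle.exp_add, Circle.exp_arg, Circle.exp_arg, mul_inv_cancel_left]
  all_goals
    have hd : dist (x⁻¹ * y) 1 = dist x y := by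
      rw [← Circle.dist_mul_left_eq x (x⁻¹ * y) 1]; simp [dist_comm]
    have := R (x := x⁻¹ * y) (by rw [hd]; exact hxy)
    simp only [Circle.coe_one, Complex.arg_one, Real.dist_eq, sub_zero] at this
  · exact this.trans_le (min_le_right _ _)
  · set t := Complex.arg (x⁻¹ * y : Circle) with ht
    have h4 := H (y := t) (by simpa [Real.dist_eq] using this.trans_le (min_le_left _ _))
    have h5 : dist x y = ‖Complex.exp (t * Complex.I) - 1‖ := by
      rw [← hd, Circle.dist_eq_norm_sub, ← Circle.coe_exp, ht, Circle.exp_arg]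
      simp
    rw [h5]
    have h6 := abs_norm_sub_norm_le (Complex.exp (t * Complex.I) - 1) (t * Complex.I)
    simp only [zero_add, Complex.ofReal_zero, zero_mul, Complex.exp_zero, Real.norm_eq_abs,
      Complex.real_smul] at h4
    rw [abs_sub_comm]
    have h7 : ‖(t : ℂ) * Complex.I‖ = |t| := by simp
    rw [h7] at h6
    exact h6.trans h4

/-- Uniform differentiability of a circle diffeomorphism, expressed through distances. -/
lemma CircleDiffeo.uniform_dist (g : CircleDiffeo) : ∀ ε > 0, ∃ ρ > 0, ∀ x y : Circle,
    dist x y < ρ → |dist (g x) (g y) - circleAbsDeriv g x * dist x y| ≤ ε * dist x y := by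
  intro ε hε
  obtain ⟨M, hM⟩ : ∃ M : ℝ, ∀ x : Circle, circleAbsDeriv g x ≤ M := by
    have hc : Continuous fun s => ‖deriv (circleLift g) s‖ :=
      ((contDiff_circleLift g).continuous_deriv le_rfl).norm
    obtain ⟨M, hM⟩ := (isCompact_Icc (a := -Real.pi) (b := Real.pi)).bddAbove_image hc.continuousOn
    refine ⟨M, fun x => ?_⟩
    rw [← Circle.exp_arg x, circleAbsDeriv_exp]
    exact hM ⟨_, ⟨(Complex.neg_pi_lt_arg _).le, Complex.arg_le_pi _⟩, rfl⟩
  have hM0 : 0 ≤ M := (norm_nonneg _).trans (hM 1)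
  obtain ⟨δ, hδ, H⟩ := circleLift_uniform_diff g (ε / 4) (by positivity)
  obtain ⟨ρ, hρ, R⟩ := Circle.exists_exp_of_dist_lt
    (min δ (min (1 / 2) (ε / (4 * (M + 1))))) (by positivity)
  refine ⟨ρ, hρ, fun x y hxy => ?_⟩
  obtain ⟨s, t, rfl, rfl, ht, hdist⟩ := R x y hxy
  set d := dist (Circle.exp s) (Circle.exp (s + t)) with hd
  have ht0 : 0 ≤ |t| := abs_nonneg t
  have a1 : |(|t|) - d| ≤ 1 / 2 * |t| := hdist.trans
    (mul_le_mul_of_nonneg_right ((min_le_right _ _).trans (min_le_left _ _)) ht0)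
  have a2 : |(|t|) - d| ≤ ε / (4 * (M + 1)) * |t| := hdist.trans
    (mul_le_mul_of_nonneg_right ((min_le_right _ _).trans (min_le_right _ _)) ht0)
  have a3 : |t| ≤ 2 * d := by have := (abs_le.1 a1).2; linarith
  have h1 := H s t (ht.trans_le (min_le_left _ _))
  have h2 : dist (g (Circle.exp s)) (g (Circle.exp (s + t))) =
      ‖circleLift g (s + t) - circleLift g s‖ := by
    rw [dist_comm, Circle.dist_eq_norm_sub]; rfl
  rw [h2, circleAbsDeriv_exp]
  have hMs := hM (Circle.exp s)
  rw [circleAbsDeriv_exp] at hMs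
  set D := ‖deriv (circleLift g) s‖ with hD
  have hD0 : 0 ≤ D := norm_nonneg _
  have h3 : |‖circleLift g (s + t) - circleLift g s‖ - |t| * D| ≤ ε / 4 * |t| := by
    have := (abs_norm_sub_norm_le (circleLift g (s + t) - circleLift g s)
      ((t : ℂ) * deriv (circleLift g) s)).trans h1
    simpa [hD] using this
  have h4 : |(|t|) * D - D * d| ≤ ε / 4 * |t| := by
    rw [mul_comm |t| D, ← mul_sub, abs_mul, abs_of_nonneg hD0]
    calc D * |(|t|) - d| ≤ (M + 1) * (ε / (4 * (M + 1)) * |t|) := by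
          gcongr; linarith
      _ = ε / 4 * |t| := by field_simp
  have h5 := abs_sub_le (‖circleLift g (s + t) - circleLift g s‖) (|t| * D) (D * d)
  nlinarith

lemma circleAbsDeriv_nonneg (g : Circle → Circle) (x : Circle) : 0 ≤ circleAbsDeriv g x :=
  norm_nonneg _

instance circle_neBot_nhdsWithin (x : Circle) : (𝓝[≠] x).NeBot := by
  rw [← mem_closure_iff_nhdsWithin_neBot, Metric.mem_closure_iff]
  intro ε hε
  have h : Continuous fun t : ℝ => x * Circle.exp t := by fun_prop
  obtain ⟨δ, hδ, H⟩ := Metric.continuous_iff.1 h 0 ε hε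
  have hpi := Real.pi_gt_three
  refine ⟨x * Circle.exp (min (δ / 2) 1), ?_, ?_⟩
  · simp only [Set.mem_compl_iff, Set.mem_singleton_iff, mul_eq_left, Circle.exp_eq_one, not_exists]
    intro n hn
    have h0 : 0 < min (δ / 2) 1 := by positivity
    have h1 : min (δ / 2) 1 ≤ 1 := min_le_right _ _
    rw [hn] at h0 h1
    have hn0 : (0 : ℝ) < n := by
      by_contra hc
      nlinarith [not_lt.1 hc]
    have hn1 : (1 : ℝ) ≤ n := by exact_mod_cast (Int.cast_pos.1 hn0 : 0 < n)
    nlinarith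
  · have := H (min (δ / 2) 1) (by
      rw [Real.dist_eq, sub_zero, abs_of_pos (by positivity)]
      exact (min_le_left _ _).trans_lt (by linarith))
    simpa [dist_comm] using this

/-- The absolute derivative is the limit of the ratio of distances. -/
lemma CircleDiffeo.tendsto_ratio (g : CircleDiffeo) (x : Circle) :
    Tendsto (fun y => dist (g x) (g y) / dist x y) (𝓝[≠] x) (𝓝 (circleAbsDeriv g x)) := by
  rw [Metric.tendsto_nhdsWithin_nhds]
  intro ε hε
  obtain ⟨ρ, hρ, H⟩ := g.uniform_dist (ε / 2) (by positivity)
  refine ⟨ρ, hρ, fun y hy hyx => ?_⟩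
  have hd : 0 < dist x y := dist_pos.2 (Ne.symm hy)
  have := H x y (by rwa [dist_comm])
  rw [Real.dist_eq, div_sub' hd.ne', abs_div, abs_of_pos hd, div_lt_iff₀ hd, mul_comm (dist x y)]
  nlinarith

/-- Ratios of distances multiply under composition, and their limits are unique because the circle
has no isolated point. -/
lemma CircleDiffeo.absDeriv_comp (g h : CircleDiffeo) (x : Circle) :
    circleAbsDeriv (g ∘ h) x = circleAbsDeriv g (h x) * circleAbsDeriv h x := by
  have h1 := CircleDiffeo.tendsto_ratio (h.trans g) x
  rw [Diffeomorph.coe_trans] at h1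
  refine tendsto_nhds_unique h1 ?_
  have hne : Tendsto h (𝓝[≠] x) (𝓝[≠] (h x)) :=
    h.continuous.continuousWithinAt.tendsto_nhdsWithin fun y hy => h.injective.ne hy
  refine (((CircleDiffeo.tendsto_ratio g (h x)).comp hne).mul
    (CircleDiffeo.tendsto_ratio h x)).congr' ?_
  filter_upwards [self_mem_nhdsWithin] with y hy
  have : dist (h x) (h y) ≠ 0 := (dist_pos.2 (h.injective.ne (Ne.symm hy))).ne'
  simp only [Function.comp_apply]
  field_simp

lemma circleAbsDeriv_id (x : Circle) : circleAbsDeriv id x = 1 := by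
  have h1 := CircleDiffeo.tendsto_ratio (Diffeomorph.refl (𝓡 1) Circle 1) x
  refine tendsto_nhds_unique h1 (tendsto_const_nhds.congr' ?_)
  filter_upwards [self_mem_nhdsWithin] with y hy
  have : dist x y ≠ 0 := (dist_pos.2 (Ne.symm hy)).ne'
  simp [this]

lemma CircleDiffeo.absDeriv_pos (g : CircleDiffeo) (x : Circle) : 0 < circleAbsDeriv g x := by
  have h := CircleDiffeo.absDeriv_comp g.symm g x
  have hid : (g.symm ∘ g : Circle → Circle) = id := by ext y; simp
  rw [hid, circleAbsDeriv_id] at h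
  refine (circleAbsDeriv_nonneg _ _).lt_of_ne fun h0 => ?_
  rw [← h0, mul_zero] at h
  exact one_ne_zero h

/-- The uniform estimate is usable with either point as base, so the derivatives at two nearby
points are both close to the same ratio. -/
lemma CircleDiffeo.continuous_absDeriv (g : CircleDiffeo) : Continuous (circleAbsDeriv g) := by
  rw [Metric.continuous_iff]
  intro x ε hε
  obtain ⟨ρ, hρ, H⟩ := g.uniform_dist (ε / 3) (by positivity)
  refine ⟨ρ, hρ, fun y hy => ?_⟩
  rcases eq_or_ne y x with rfl | hne
  · simpa using hε
  have hd : 0 < dist y x := dist_pos.2 hne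
  have h1 := abs_le.1 (H y x hy)
  have h2 := abs_le.1 (H x y (by rwa [dist_comm]))
  rw [dist_comm (g x), dist_comm x] at h2
  rw [Real.dist_eq, abs_lt]
  constructor <;> nlinarith

/-- This is the form in which smoothness enters the abstract argument. The additive error becomes a
factor `exp τ` because the derivative is bounded below by its positive minimum. -/
lemma CircleDiffeo.local_lipschitz (g : CircleDiffeo) : ∀ τ > 0, ∃ ρ > 0, ∀ x y : Circle,
    dist x y < ρ →
      dist (g x) (g y) ≤ Real.exp (Real.log (circleAbsDeriv g x) + τ) * dist x y := by
  intro τ hτ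
  obtain ⟨x₀, -, hx₀⟩ := isCompact_univ.exists_isMinOn Set.univ_nonempty
    g.continuous_absDeriv.continuousOn
  have hpos := g.absDeriv_pos x₀
  have hexp : 0 < Real.exp τ - 1 := by linarith [Real.add_one_lt_exp hτ.ne']
  obtain ⟨ρ, hρ, H⟩ := g.uniform_dist (circleAbsDeriv g x₀ * (Real.exp τ - 1)) (by positivity)
  refine ⟨ρ, hρ, fun x y hxy => ?_⟩
  rw [Real.exp_add, Real.exp_log (g.absDeriv_pos x)]
  have h1 := (abs_le.1 (H x y hxy)).2
  have h2 : circleAbsDeriv g x₀ * (Real.exp τ - 1) * dist x y ≤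
      circleAbsDeriv g x * (Real.exp τ - 1) * dist x y := by
    gcongr
    exact hx₀ (Set.mem_univ x)
  linarith

lemma CircleDiffeo.continuous_log_absDeriv (g : CircleDiffeo) :
    Continuous fun x => Real.log (circleAbsDeriv g x) :=
  g.continuous_absDeriv.log fun x => (g.absDeriv_pos x).ne'

/-! ### Skew products over the shift: words and sums along fibre orbits -/

section SkewProduct

variable {k : ℕ} {X : Type*}

/-- The skew product over the one-sided shift of a family of self-maps. -/
def skewMap (f : Fin k → X → X) (p : (ℕ → Fin k) × X) : (ℕ → Fin k) × X :=
  (fun n => p.1 (n + 1), f (p.1 0) p.2)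

/-- A family of functions on the fibre, as a function on the phase space of the skew product. -/
def fibreFun (φ : Fin k → X → ℝ) (p : (ℕ → Fin k) × X) : ℝ := φ (p.1 0) p.2

/-- The composition `f_{ω_{n-1}} ∘ ⋯ ∘ f_{ω_0}`. -/
def fibreMap (f : Fin k → X → X) (ω : ℕ → Fin k) (n : ℕ) (x : X) : X :=
  ((skewMap f)^[n] (ω, x)).2

/-- The Birkhoff sum of `φ` along the fibre orbit of `x` driven by `ω`. -/
def fibreSum (f : Fin k → X → X) (φ : Fin k → X → ℝ) (ω : ℕ → Fin k) (n : ℕ) (x : X) : ℝ :=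
  birkhoffSum (skewMap f) (fibreFun φ) n (ω, x)

/-- The sequence that follows `ω` for `n` steps and then `ω'`. -/
def glue (ω : ℕ → Fin k) (n : ℕ) (ω' : ℕ → Fin k) : ℕ → Fin k :=
  fun i => if i < n then ω i else ω' (i - n)

/-- The periodic sequence that repeats the first `n` symbols of `ω`. -/
def periodize (ω : ℕ → Fin k) (n : ℕ) : ℕ → Fin k := fun i => ω (i % n)

variable (f : Fin k → X → X) (φ : Fin k → X → ℝ)

lemma skewMap_iterate (n : ℕ) (p : (ℕ → Fin k) × X) :
    (skewMap f)^[n] p = (fun i => p.1 (i + n), fibreMap f p.1 n p.2) := by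
  refine Prod.ext ?_ rfl
  induction n generalizing p with
  | zero => rfl
  | succ n ih =>
    rw [Function.iterate_succ_apply, ih]
    funext i
    simp only [skewMap]
    congr 1

@[simp] lemma fibreMap_zero (ω : ℕ → Fin k) (x : X) : fibreMap f ω 0 x = x := rfl

@[simp] lemma fibreSum_zero (ω : ℕ → Fin k) (x : X) : fibreSum f φ ω 0 x = 0 := by
  simp [fibreSum]

lemma fibreMap_add (ω : ℕ → Fin k) (m n : ℕ) (x : X) :
    fibreMap f ω (m + n) x = fibreMap f (fun i => ω (i + m)) n (fibreMap f ω m x) := by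
  rw [fibreMap, add_comm, Function.iterate_add_apply, skewMap_iterate f m]
  rfl

lemma fibreMap_succ (ω : ℕ → Fin k) (n : ℕ) (x : X) :
    fibreMap f ω (n + 1) x = f (ω n) (fibreMap f ω n x) := by
  rw [fibreMap_add]
  simp [fibreMap, skewMap]

lemma fibreSum_add (ω : ℕ → Fin k) (m n : ℕ) (x : X) :
    fibreSum f φ ω (m + n) x =
      fibreSum f φ ω m x + fibreSum f φ (fun i => ω (i + m)) n (fibreMap f ω m x) := by
  rw [fibreSum, birkhoffSum_add, skewMap_iterate f m]
  rfl

lemma fibreSum_succ (ω : ℕ → Fin k) (n : ℕ) (x : X) :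
    fibreSum f φ ω (n + 1) x = fibreSum f φ ω n x + φ (ω n) (fibreMap f ω n x) := by
  rw [fibreSum_add]
  simp [fibreSum, fibreFun]

lemma fibreMap_congr {ω ω' : ℕ → Fin k} {n : ℕ} (h : ∀ i < n, ω i = ω' i) (x : X) :
    fibreMap f ω n x = fibreMap f ω' n x := by
  induction n with
  | zero => rfl
  | succ n ih =>
    rw [fibreMap_succ, fibreMap_succ, ih fun i hi => h i (hi.trans n.lt_succ_self),
      h n n.lt_succ_self]

lemma fibreSum_congr {ω ω' : ℕ → Fin k} {n : ℕ} (h : ∀ i < n, ω i = ω' i) (x : X) :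
    fibreSum f φ ω n x = fibreSum f φ ω' n x := by
  induction n with
  | zero => simp
  | succ n ih =>
    have h' : ∀ i < n, ω i = ω' i := fun i hi => h i (hi.trans n.lt_succ_self)
    rw [fibreSum_succ, fibreSum_succ, ih h', h n n.lt_succ_self, fibreMap_congr f h']

lemma glue_of_lt {ω ω' : ℕ → Fin k} {n i : ℕ} (h : i < n) : glue ω n ω' i = ω i := if_pos h

lemma glue_add (ω ω' : ℕ → Fin k) (n i : ℕ) : glue ω n ω' (i + n) = ω' i := by
  simp [glue]

lemma fibreMap_glue_of_le {ω ω' : ℕ → Fin k} {n j : ℕ} (h : j ≤ n) (x : X) :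
    fibreMap f (glue ω n ω') j x = fibreMap f ω j x :=
  fibreMap_congr f (fun _ hi => glue_of_lt (hi.trans_le h)) x

lemma fibreSum_glue_of_le {ω ω' : ℕ → Fin k} {n j : ℕ} (h : j ≤ n) (x : X) :
    fibreSum f φ (glue ω n ω') j x = fibreSum f φ ω j x :=
  fibreSum_congr f φ (fun _ hi => glue_of_lt (hi.trans_le h)) x

lemma fibreMap_glue_add (ω ω' : ℕ → Fin k) (n j : ℕ) (x : X) :
    fibreMap f (glue ω n ω') (n + j) x = fibreMap f ω' j (fibreMap f ω n x) := by
  rw [fibreMap_add, fibreMap_glue_of_le f le_rfl]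
  simp only [glue_add]

lemma fibreSum_glue_add (ω ω' : ℕ → Fin k) (n j : ℕ) (x : X) :
    fibreSum f φ (glue ω n ω') (n + j) x =
      fibreSum f φ ω n x + fibreSum f φ ω' j (fibreMap f ω n x) := by
  rw [fibreSum_add, fibreMap_glue_of_le f le_rfl, fibreSum_glue_of_le f φ le_rfl]
  simp only [glue_add]

lemma periodize_of_lt {ω : ℕ → Fin k} {n i : ℕ} (h : i < n) : periodize ω n i = ω i := by
  simp [periodize, Nat.mod_eq_of_lt h]

lemma isPeriodicPt_periodize {ω : ℕ → Fin k} {n : ℕ} {x : X} (h : fibreMap f ω n x = x) :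
    Function.IsPeriodicPt (skewMap f) n (periodize ω n, x) := by
  rw [Function.IsPeriodicPt, Function.IsFixedPt, skewMap_iterate]
  refine Prod.ext ?_ ?_
  · funext i; simp [periodize]
  · exact (fibreMap_congr f (fun i hi => periodize_of_lt hi) x).trans h

lemma birkhoffSum_periodize {ω : ℕ → Fin k} {n : ℕ} {x : X} :
    birkhoffSum (skewMap f) (fibreFun φ) n (periodize ω n, x) = fibreSum f φ ω n x :=
  fibreSum_congr f φ (fun _ hi => periodize_of_lt hi) x

lemma abs_fibreSum_le {M : ℝ} (hM : ∀ i x, |φ i x| ≤ M) (ω : ℕ → Fin k) (n : ℕ) (x : X) :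
    |fibreSum f φ ω n x| ≤ n * M := by
  induction n with
  | zero => simp
  | succ n ih =>
    rw [fibreSum_succ]
    have := (abs_add_le (fibreSum f φ ω n x) (φ (ω n) (fibreMap f ω n x))).trans
      (add_le_add ih (hM _ _))
    push_cast
    linarith

variable {f φ}

lemma continuous_skewMap [TopologicalSpace X] (hf : ∀ i, Continuous (f i)) :
    Continuous (skewMap f) := by
  refine Continuous.prodMk (by fun_prop) ?_
  have : Continuous fun q : Fin k × X => f q.1 q.2 := continuous_prod_of_discrete_left.2 hf
  exact this.comp (f := fun p : (ℕ → Fin k) × X => (p.1 0, p.2)) (by fun_prop)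

lemma continuous_fibreFun [TopologicalSpace X] (hφ : ∀ i, Continuous (φ i)) :
    Continuous (fibreFun φ) := by
  have : Continuous fun q : Fin k × X => φ q.1 q.2 := continuous_prod_of_discrete_left.2 hφ
  exact this.comp (f := fun p : (ℕ → Fin k) × X => (p.1 0, p.2)) (by fun_prop)

lemma continuous_fibreMap [TopologicalSpace X] (hf : ∀ i, Continuous (f i)) (ω : ℕ → Fin k)
    (n : ℕ) : Continuous (fibreMap f ω n) :=
  continuous_snd.comp (((continuous_skewMap hf).iterate n).comp (by fun_prop))

lemma continuous_fibreSum [TopologicalSpace X] (hf : ∀ i, Continuous (f i))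
    (hφ : ∀ i, Continuous (φ i)) (ω : ℕ → Fin k) (n : ℕ) : Continuous (fibreSum f φ ω n) := by
  have : fibreSum f φ ω n = fun x =>
      ∑ j ∈ Finset.range n, fibreFun φ ((skewMap f)^[j] (ω, x)) := rfl
  rw [this]
  exact continuous_finsetSum _ fun j _ =>
    (continuous_fibreFun hφ).comp (((continuous_skewMap hf).iterate j).comp (by fun_prop))

/-- Every prescribed amount of expansion can be realized, up to a bounded error and without
overshooting on the way, within a time proportional to it. -/
lemma exists_expanding_word {a M : ℝ} {B : ℕ} (ha : 0 < a) (hM : ∀ i x, |φ i x| ≤ M)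
    (hB : ∀ x, ∃ ω, ∃ n ≤ B, a ≤ fibreSum f φ ω n x) {t : ℝ} (ht : 0 ≤ t) (x : X) :
    ∃ ω n, t ≤ fibreSum f φ ω n x ∧ (∀ j ≤ n, fibreSum f φ ω j x ≤ t + B * M) ∧
      a * n ≤ B * (t + B * M) := by
  have hM0 : 0 ≤ M := by
    obtain ⟨ω, -⟩ := hB x
    exact (abs_nonneg _).trans (hM (ω 0) x)
  have hBM : 0 ≤ B * M := by positivity
  have hle : ∀ ω n x, n ≤ B → fibreSum f φ ω n x ≤ B * M := fun ω n x hn =>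
    (le_abs_self _).trans ((abs_fibreSum_le f φ hM ω n x).trans (by gcongr))
  -- Induction on the number of blocks gaining at least `a`. The last block may overshoot, leaving a
  -- negative target, but never below `-(B * M)`; hence the wider range of `t`.
  suffices H : ∀ m : ℕ, ∀ (t : ℝ) (x : X), t ≤ m * a → -(B * M) ≤ t →
      ∃ ω n, t ≤ fibreSum f φ ω n x ∧ (∀ j ≤ n, fibreSum f φ ω j x ≤ t + B * M) ∧
        a * n ≤ B * (t + B * M) by
    obtain ⟨m, hm⟩ := exists_nat_ge (t / a)
    exact H m t x ((div_le_iff₀ ha).1 hm) (by linarith)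
  have base : ∀ (t : ℝ) (x : X), t ≤ 0 → -(B * M) ≤ t →
      ∃ ω n, t ≤ fibreSum f φ ω n x ∧ (∀ j ≤ n, fibreSum f φ ω j x ≤ t + B * M) ∧
        a * n ≤ B * (t + B * M) := by
    intro t x h1 h2
    obtain ⟨ω, -⟩ := hB x
    refine ⟨ω, 0, by simpa using h1, fun j hj => ?_, ?_⟩
    · obtain rfl := Nat.le_zero.1 hj
      simp; linarith
    · simp only [Nat.cast_zero, mul_zero]
      exact mul_nonneg B.cast_nonneg (by linarith)
  intro m
  induction m with
  | zero => intro t x h1 h2; exact base t x (by simpa using h1) h2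
  | succ m ih =>
    intro t x h1 h2
    rcases le_or_gt t 0 with h0 | h0
    · exact base t x h0 h2
    obtain ⟨ω, n, hn, hs⟩ := hB x
    have hs' := hle ω n x hn
    push_cast at h1
    obtain ⟨ω', n', e1, e2, e3⟩ := ih (t - fibreSum f φ ω n x) (fibreMap f ω n x)
      (by linarith) (by linarith)
    refine ⟨glue ω n ω', n + n', ?_, fun j hj => ?_, ?_⟩
    · rw [fibreSum_glue_add]; linarith
    · rcases le_total j n with hjn | hjn
      · rw [fibreSum_glue_of_le f φ hjn]
        linarith [hle ω j x (hjn.trans hn)]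
      · obtain ⟨i, rfl⟩ := Nat.exists_eq_add_of_le hjn
        rw [fibreSum_glue_add]
        linarith [e2 i (by omega)]
    · have : (n : ℝ) ≤ B := by exact_mod_cast hn
      have h5 : (B : ℝ) * a ≤ B * fibreSum f φ ω n x := by gcongr
      have h6 : a * n ≤ a * B := by gcongr
      push_cast
      nlinarith

lemma birkhoffSum_mul_add_of_isPeriodicPt {α : Type*} {F : α → α} {p : α} {n : ℕ}
    (hp : Function.IsPeriodicPt F n p) (g : α → ℝ) (N r : ℕ) :
    birkhoffSum F g (N * n + r) p = N * birkhoffSum F g n p + birkhoffSum F g r p := by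
  induction N with
  | zero => simp
  | succ N ih =>
    have : (N + 1) * n + r = n + (N * n + r) := by ring
    rw [this, birkhoffSum_add, hp.eq, ih]
    push_cast
    ring

lemma exists_pos_forall_of_antitone {ι : Type*} [Finite ι] {P : ι → ℝ → Prop}
    (hP : ∀ i a b, a ≤ b → P i b → P i a) (h : ∀ i, ∃ ρ > 0, P i ρ) :
    ∃ ρ > 0, ∀ i, P i ρ := by
  have h1 : ∀ᶠ ρ in 𝓝[>] (0 : ℝ), ∀ i, P i ρ := by
    refine eventually_all.2 fun i => ?_
    obtain ⟨ρ, hρ, hi⟩ := h i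
    filter_upwards [Ioo_mem_nhdsGT hρ] with b hb using hP i b ρ hb.2.le hi
  obtain ⟨ρ, hρ, hpos⟩ := (h1.and self_mem_nhdsWithin).exists
  exact ⟨ρ, hpos, hρ⟩

/-- For comparing the means of a test function along two orbits that agree up to time `P`: a
function that sees `m` symbols ahead gives no comparison at the last `m` times, which cost at most
`1` each. -/
lemma sum_range_sub_le {a b : ℕ → ℝ} {P L m : ℕ} {ε : ℝ} (hPL : P ≤ L) (hε : 0 ≤ ε)
    (ha : ∀ j, a j ≤ 1) (hb : ∀ j, 0 ≤ b j) (h : ∀ j, j + m ≤ P → a j - ε ≤ b j) :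
    ∑ j ∈ Finset.range P, a j - m - ε * P ≤ ∑ j ∈ Finset.range L, b j := by
  have h1 : ∀ j ∈ Finset.range P, a j - ε - (if P < j + m then 1 else 0) ≤ b j := by
    intro j _
    split_ifs with hj
    · linarith [ha j, hb j]
    · linarith [h j (not_lt.1 hj)]
  have h2 := Finset.sum_le_sum h1
  have h3 : ∑ j ∈ Finset.range P, b j ≤ ∑ j ∈ Finset.range L, b j :=
    Finset.sum_le_sum_of_subset_of_nonneg (Finset.range_subset_range.2 hPL) fun j _ _ => hb j
  have h4 : (∑ j ∈ Finset.range P, if P < j + m then (1 : ℝ) else 0) ≤ m := by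
    rw [Finset.sum_boole]
    norm_cast
    refine (Finset.card_le_card (t := Finset.Ico (P - m) P) fun j hj => ?_).trans ?_
    · simp only [Finset.mem_filter, Finset.mem_range, Finset.mem_Ico] at hj ⊢
      omega
    · rw [Nat.card_Ico]
      omega
  rw [Finset.sum_sub_distrib, Finset.sum_sub_distrib] at h2
  simp only [Finset.sum_const, Finset.card_range, nsmul_eq_mul] at h2
  linarith

/-! ### Shadowing and closing -/

section Metric

variable [MetricSpace X]

/-- As long as the predicted distance stays below the scale `ρ`, the one-step estimate applies
again, and each step costs one `τ` of distortion. -/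
lemma fibreMap_shadow {τ ρ : ℝ}
    (hρ : ∀ i x y, dist x y < ρ → dist (f i x) (f i y) ≤ Real.exp (φ i x + τ) * dist x y ∧
      |φ i x - φ i y| ≤ τ)
    {ω : ℕ → Fin k} {n : ℕ} {x y : X}
    (h : ∀ j < n, Real.exp (fibreSum f φ ω j x + τ * j) * dist x y < ρ) :
    dist (fibreMap f ω n x) (fibreMap f ω n y) ≤
      Real.exp (fibreSum f φ ω n x + τ * n) * dist x y ∧
    |fibreSum f φ ω n x - fibreSum f φ ω n y| ≤ τ * n := by
  induction n with
  | zero => simp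
  | succ n ih =>
    obtain ⟨h1, h2⟩ := ih fun j hj => h j (hj.trans n.lt_succ_self)
    obtain ⟨h3, h4⟩ := hρ (ω n) _ _ (h1.trans_lt (h n n.lt_succ_self))
    rw [fibreMap_succ, fibreMap_succ, fibreSum_succ, fibreSum_succ]
    constructor
    · calc _ ≤ Real.exp (φ (ω n) (fibreMap f ω n x) + τ) *
            (Real.exp (fibreSum f φ ω n x + τ * n) * dist x y) :=
          h3.trans (mul_le_mul_of_nonneg_left h1 (Real.exp_pos _).le)
        _ = _ := by
          rw [← mul_assoc, ← Real.exp_add]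
          push_cast
          ring_nf
    · have := abs_add_le (fibreSum f φ ω n x - fibreSum f φ ω n y)
        (φ (ω n) (fibreMap f ω n x) - φ (ω n) (fibreMap f ω n y))
      rw [add_sub_add_comm]
      push_cast
      linarith

/-- A point that is almost returned to itself by a strongly contracting composition is shadowed by
a fixed point of this composition. -/
lemma exists_fixedPoint_fibreMap [CompleteSpace X] {τ ρ r : ℝ} (hτ : 0 ≤ τ) (hr : 0 < r)
    (hρ : ∀ i x y, dist x y < ρ → dist (f i x) (f i y) ≤ Real.exp (φ i x + τ) * dist x y ∧
      |φ i x - φ i y| ≤ τ)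
    {ω : ℕ → Fin k} {n : ℕ} {x : X}
    (h : ∀ j ≤ n, Real.exp (fibreSum f φ ω j x + 2 * τ * j) * (2 * r) < ρ)
    (hn : Real.exp (fibreSum f φ ω n x + 2 * τ * n) ≤ 1 / 2)
    (hx : dist (fibreMap f ω n x) x ≤ r / 2) :
    ∃ q, fibreMap f ω n q = q ∧
      (∀ j ≤ n, dist (fibreMap f ω j x) (fibreMap f ω j q) ≤
        Real.exp (fibreSum f φ ω j x + 2 * τ * j) * r) ∧
      |fibreSum f φ ω n x - fibreSum f φ ω n q| ≤ τ * n := by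
  have hmono : ∀ j : ℕ, Real.exp (fibreSum f φ ω j x + τ * j) ≤
      Real.exp (fibreSum f φ ω j x + 2 * τ * j) := fun j => by
    apply Real.exp_le_exp.2
    have : 0 ≤ τ * j := by positivity
    linarith
  have h1 : ∀ j ≤ n, ∀ z ∈ Metric.closedBall x r,
      dist (fibreMap f ω j x) (fibreMap f ω j z) ≤
        Real.exp (fibreSum f φ ω j x + τ * j) * dist x z ∧
      |fibreSum f φ ω j x - fibreSum f φ ω j z| ≤ τ * j := by
    intro j hj z hz
    refine fibreMap_shadow hρ fun i hi => lt_of_le_of_lt ?_ (h i (hi.le.trans hj))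
    rw [Metric.mem_closedBall, dist_comm] at hz
    exact mul_le_mul (hmono i) (by linarith) dist_nonneg (Real.exp_pos _).le
  -- Shadowing is restarted at `z` instead of `x`. This costs a second `τ` per step, and distances
  -- up to the diameter `2 * r` of the ball: hence `2 * τ * j` and `2 * r` in `h`.
  have h2 : ∀ z ∈ Metric.closedBall x r, ∀ z' ∈ Metric.closedBall x r,
      dist (fibreMap f ω n z) (fibreMap f ω n z') ≤ 1 / 2 * dist z z' := by
    intro z hz z' hz'
    have key : ∀ j ≤ n, Real.exp (fibreSum f φ ω j z + τ * j) ≤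
        Real.exp (fibreSum f φ ω j x + 2 * τ * j) := fun j hj => by
      apply Real.exp_le_exp.2
      have := (abs_le.1 (h1 j hj z hz).2).1
      linarith
    have hzz : dist z z' ≤ 2 * r := by
      have := dist_triangle_right z z' x
      rw [Metric.mem_closedBall] at hz hz'
      linarith
    refine (fibreMap_shadow hρ fun i hi => lt_of_le_of_lt ?_ (h i hi.le)).1.trans
      (mul_le_mul_of_nonneg_right ((key n le_rfl).trans hn) dist_nonneg)
    exact mul_le_mul (key i hi.le) hzz dist_nonneg (Real.exp_pos _).le
  have hxr : x ∈ Metric.closedBall x r := Metric.mem_closedBall_self hr.le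
  have hmaps : Set.MapsTo (fibreMap f ω n) (Metric.closedBall x r) (Metric.closedBall x r) := by
    intro z hz
    have h3 := h2 z hz x hxr
    rw [Metric.mem_closedBall] at hz ⊢
    have := dist_triangle (fibreMap f ω n z) (fibreMap f ω n x) x
    linarith
  have hcontr : ContractingWith (1 / 2) (hmaps.restrict (fibreMap f ω n) _ _) := by
    refine ⟨by norm_num, LipschitzWith.of_dist_le_mul fun z z' => ?_⟩
    have := h2 z z.2 z' z'.2
    simpa [Subtype.dist_eq] using this
  obtain ⟨q, hq, hfix, -, -⟩ := hcontr.exists_fixedPoint' Metric.isClosed_closedBall.isComplete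
    hmaps hxr (edist_ne_top _ _)
  refine ⟨q, hfix, fun j hj => (h1 j hj q hq).1.trans ?_, (h1 n le_rfl q hq).2⟩
  rw [Metric.mem_closedBall, dist_comm] at hq
  exact mul_le_mul (hmono j) hq dist_nonneg (Real.exp_pos _).le

/-! ### Uniform reachability and uniform expansion -/

variable [CompactSpace X]

/-- The points that reach `V` in time at most `B` form an open set growing with `B`, so compactness
applies. -/
lemma exists_uniform_reach (hf : ∀ i, Continuous (f i))
    (hmin : ∀ x, ∀ V : Set X, IsOpen V → V.Nonempty → ∃ ω n, fibreMap f ω n x ∈ V)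
    {V : Set X} (hV : IsOpen V) (hne : V.Nonempty) :
    ∃ B : ℕ, ∀ x, ∃ ω, ∃ n ≤ B, fibreMap f ω n x ∈ V := by
  obtain ⟨B, hB⟩ := isCompact_univ.elim_directed_cover
    (fun B : ℕ => {x | ∃ ω, ∃ n ≤ B, fibreMap f ω n x ∈ V})
    (fun B => by
      have : {x | ∃ ω, ∃ n ≤ B, fibreMap f ω n x ∈ V} =
          ⋃ ω, ⋃ n, ⋃ (_ : n ≤ B), fibreMap f ω n ⁻¹' V := by ext; simp
      rw [this]
      exact isOpen_iUnion fun ω => isOpen_iUnion fun n => isOpen_iUnion fun _ =>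
        hV.preimage (continuous_fibreMap hf ω n))
    (fun x _ => by
      obtain ⟨ω, n, h⟩ := hmin x V hV hne
      exact Set.mem_iUnion.2 ⟨n, ω, n, le_rfl, h⟩)
    (directed_of_isDirected_le fun a b hab x ⟨ω, n, hn, h⟩ => ⟨ω, n, hn.trans hab, h⟩)
  exact ⟨B, fun x => hB (Set.mem_univ x)⟩

lemma exists_uniform_expansion (hf : ∀ i, Continuous (f i)) (hφ : ∀ i, Continuous (φ i))
    (hexp : ∀ x, ∃ ω n, 0 < fibreSum f φ ω n x) :
    ∃ a > 0, ∃ B : ℕ, ∀ x, ∃ ω, ∃ n ≤ B, a ≤ fibreSum f φ ω n x := by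
  obtain ⟨B, hB⟩ := isCompact_univ.elim_directed_cover
    -- One parameter serves as both the time bound and the inverse of the gain, so that the open
    -- sets increase with it.
    (fun B : ℕ => {x | ∃ ω, ∃ n ≤ B, 1 / ((B : ℝ) + 1) < fibreSum f φ ω n x})
    (fun B => by
      have : {x | ∃ ω, ∃ n ≤ B, 1 / ((B : ℝ) + 1) < fibreSum f φ ω n x} =
          ⋃ ω, ⋃ n, ⋃ (_ : n ≤ B), fibreSum f φ ω n ⁻¹' Set.Ioi (1 / ((B : ℝ) + 1)) := by
        ext; simp
      rw [this]
      exact isOpen_iUnion fun ω => isOpen_iUnion fun n => isOpen_iUnion fun _ =>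
        isOpen_Ioi.preimage (continuous_fibreSum hf hφ ω n))
    (fun x _ => by
      obtain ⟨ω, n, h⟩ := hexp x
      obtain ⟨N, hN⟩ := exists_nat_one_div_lt h
      refine Set.mem_iUnion.2 ⟨max n N, ω, n, le_max_left _ _, lt_of_le_of_lt ?_ hN⟩
      have : (N : ℝ) ≤ (max n N : ℕ) := by exact_mod_cast le_max_right _ _
      gcongr)
    (directed_of_isDirected_le fun a b hab x ⟨ω, n, hn, h⟩ => ⟨ω, n, hn.trans hab,
      lt_of_le_of_lt (by gcongr) h⟩)
  refine ⟨1 / ((B : ℝ) + 1), by positivity, B, fun x => ?_⟩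
  obtain ⟨ω, n, hn, h⟩ := hB (Set.mem_univ x)
  exact ⟨ω, n, hn, h.le⟩

/-- Starting anywhere, one can visit a given open set of the phase space robustly and then reach a
given open set of the fibre, in bounded time. -/
lemma exists_uniform_bridge (hf : ∀ i, Continuous (f i))
    (hmin : ∀ x, ∀ V : Set X, IsOpen V → V.Nonempty → ∃ ω n, fibreMap f ω n x ∈ V)
    {V : Set X} (hV : IsOpen V) (hVne : V.Nonempty)
    {U : Set ((ℕ → Fin k) × X)} (hU : IsOpen U) (hUne : U.Nonempty) :
    ∃ η > 0, ∃ D : ℕ, ∀ x, ∃ ω, ∃ n ≤ D, fibreMap f ω n x ∈ V ∧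
      ∃ j ≤ n, ∀ ω' : ℕ → Fin k, (∀ i < n, ω' i = ω i) →
        ∀ y, dist (fibreMap f ω j x) y < η → ((fun i => ω' (i + j)), y) ∈ U := by
  obtain ⟨⟨ν, z⟩, hz⟩ := hUne
  obtain ⟨s, t, hs, ht, hνs, hzt, hst⟩ := isOpen_prod_iff.1 hU ν z hz
  obtain ⟨I, u, hu, hIs⟩ := isOpen_pi_iff.1 hs ν hνs
  obtain ⟨m, hm⟩ : ∃ m, ∀ i ∈ I, i < m :=
    ⟨I.sup id + 1, fun i hi => Nat.lt_succ_of_le (Finset.le_sup (f := id) hi)⟩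
  obtain ⟨η, hη, hball⟩ := Metric.isOpen_iff.1 ht z hzt
  obtain ⟨B₁, hB₁⟩ := exists_uniform_reach hf hmin (Metric.isOpen_ball (x := z) (ε := η / 2))
    ⟨z, Metric.mem_ball_self (by positivity)⟩
  obtain ⟨B₂, hB₂⟩ := exists_uniform_reach hf hmin hV hVne
  refine ⟨η / 2, by positivity, B₁ + (m + B₂), fun x => ?_⟩
  obtain ⟨ω₁, n₁, hn₁, h₁⟩ := hB₁ x
  obtain ⟨ω₂, n₂, hn₂, h₂⟩ := hB₂ (fibreMap f ν m (fibreMap f ω₁ n₁ x))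
  -- Come within `η / 2` of `z`, then read the `m` symbols of `ν` that determine the cylinder, then
  -- go to `V`. The visit to `U` takes place at time `n₁`, with a margin `η / 2` in the fibre.
  refine ⟨glue ω₁ n₁ (glue ν m ω₂), n₁ + (m + n₂), by omega, ?_, n₁, by omega, ?_⟩
  · rw [fibreMap_glue_add, fibreMap_glue_add]
    exact h₂
  · intro ω' hω' y hy
    rw [fibreMap_glue_of_le f le_rfl] at hy
    refine hst ⟨hIs fun i hi => ?_, hball ?_⟩
    · have hi' : i < m := hm i hi
      show ω' (i + n₁) ∈ u i
      rw [hω' _ (by omega), glue_add, glue_of_lt hi']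
      exact (hu i hi).2
    · rw [Metric.mem_ball] at h₁ ⊢
      rw [dist_comm] at hy
      linarith [dist_triangle y (fibreMap f ω₁ n₁ x) z]

/-- Uniform continuity of finitely many test functions on the phase space. -/
lemma exists_modulus (T : Finset C((ℕ → Fin k) × X, ℝ)) {ε : ℝ} (hε : 0 < ε) :
    ∃ m : ℕ, ∃ ρ > 0, ∀ ψ ∈ T, ∀ p q : (ℕ → Fin k) × X, (∀ i < m, p.1 i = q.1 i) →
      dist p.2 q.2 < ρ → |ψ p - ψ q| < ε := by
  classical
  induction T using Finset.induction_on with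
  | empty => exact ⟨0, 1, one_pos, by simp⟩
  | insert ψ T _ ih =>
    obtain ⟨m₁, ρ₁, hρ₁, h₁⟩ := ih
    suffices H : ∃ m : ℕ, ∃ ρ > 0, ∀ p q : (ℕ → Fin k) × X, (∀ i < m, p.1 i = q.1 i) →
        dist p.2 q.2 < ρ → |ψ p - ψ q| < ε by
      obtain ⟨m₂, ρ₂, hρ₂, h₂⟩ := H
      refine ⟨max m₁ m₂, min ρ₁ ρ₂, lt_min hρ₁ hρ₂, fun χ hχ p q hpq hd => ?_⟩
      rcases Finset.mem_insert.1 hχ with rfl | hχ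
      · exact h₂ p q (fun i hi => hpq i (hi.trans_le (le_max_right _ _)))
          (hd.trans_le (min_le_right _ _))
      · exact h₁ χ hχ p q (fun i hi => hpq i (hi.trans_le (le_max_left _ _)))
          (hd.trans_le (min_le_left _ _))
    -- In this metric, agreement of the first `m` symbols means distance at most `(1 / 2) ^ m`.
    let _ : MetricSpace (ℕ → Fin k) := PiNat.metricSpace
    have huc : UniformContinuous ψ := CompactSpace.uniformContinuous_of_continuous ψ.continuous
    obtain ⟨δ, hδ, H⟩ := Metric.uniformContinuous_iff.1 huc ε hε
    obtain ⟨m, hm⟩ := exists_pow_lt_of_lt_one hδ (by norm_num : (1 / 2 : ℝ) < 1)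
    refine ⟨m, δ, hδ, fun p q hpq hd => ?_⟩
    have := H (a := p) (b := q) (by
      rw [Prod.dist_eq]
      refine max_lt (lt_of_le_of_lt ?_ hm) hd
      rw [← PiNat.mem_cylinder_iff_dist_le]
      exact fun i hi => hpq i hi)
    rwa [Real.dist_eq] at this

end Metric

end SkewProduct

/-! ### Improving a periodic orbit -/

/-- Here `P` is the time spent along the old orbit, `l` the new period, `A` the old mean and `S` the
new sum. With `u = (κ + 1) * Λ`, the bound rests on `(1 - u) * (1 + u) ≤ 1` if `u ≤ 1`; otherwise
the coefficient of `A` is negative and there is little to prove. -/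
lemma weighted_average_bound {P l A Λ κ c m ε S : ℝ} (hA : 0 ≤ A) (hA1 : A ≤ 1) (hΛ : 0 ≤ Λ)
    (hκ : 0 ≤ κ) (hc : 0 ≤ c) (hP : 0 ≤ P) (hε : 0 ≤ ε) (hPl : P ≤ l)
    (hl : l ≤ P + κ * Λ * P + c) (hmc : m + c ≤ ε / 2 * P)
    (hS : P * A - m - ε / 2 * P ≤ S) :
    ((1 - (κ + 1) * Λ) * A - ε) * l ≤ S := by
  have h1 : ε * P ≤ ε * l := by gcongr
  have h0 : 0 ≤ P * A := by positivity
  rcases le_or_gt ((κ + 1) * Λ) 1 with h | h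
  · have h2 : l ≤ P + (κ + 1) * Λ * P + c := by nlinarith [mul_nonneg hΛ hP]
    have h3 : (1 - (κ + 1) * Λ) * A * l ≤
        (1 - (κ + 1) * Λ) * A * (P + (κ + 1) * Λ * P + c) := by
      gcongr
    have h4 : (1 - (κ + 1) * Λ) * A ≤ 1 := by
      have : 0 ≤ (κ + 1) * Λ := by positivity
      nlinarith
    have h5 : (1 - (κ + 1) * Λ) * A * c ≤ c := by nlinarith
    have h6 : 0 ≤ A * P * ((κ + 1) * Λ) ^ 2 := by positivity
    nlinarith
  · have h2 : (1 - (κ + 1) * Λ) * A * l ≤ 0 := by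
      refine mul_nonpos_of_nonpos_of_nonneg (mul_nonpos_of_nonpos_of_nonneg ?_ hA) (hP.trans hPl)
      linarith
    nlinarith

lemma exists_nat_ge_three (b₁ b₂ b₃ : ℝ) : ∃ N : ℕ, 1 ≤ N ∧ b₁ ≤ N ∧ b₂ ≤ N ∧ b₃ ≤ N := by
  obtain ⟨N, hN⟩ := exists_nat_ge (max b₁ (max b₂ (max b₃ 1)))
  simp only [max_le_iff] at hN
  exact ⟨N, by exact_mod_cast hN.2.2.2, hN.1, hN.2.1, hN.2.2.1⟩

section

variable {k : ℕ} {X : Type*} [MetricSpace X] [CompactSpace X] {f : Fin k → X → X}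
  {φ : Fin k → X → ℝ}

lemma exists_distortion_scale (hφ : ∀ i, Continuous (φ i))
    (hlip : ∀ i, ∀ τ > 0, ∃ ρ > 0, ∀ x y, dist x y < ρ →
      dist (f i x) (f i y) ≤ Real.exp (φ i x + τ) * dist x y) {τ : ℝ} (hτ : 0 < τ) :
    ∃ ρ > 0, ∀ i x y, dist x y < ρ →
      dist (f i x) (f i y) ≤ Real.exp (φ i x + τ) * dist x y ∧ |φ i x - φ i y| ≤ τ := by
  refine exists_pos_forall_of_antitone (fun i a b hab h x y hd => h x y (hd.trans_le hab))
    fun i => ?_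
  obtain ⟨ρ₁, hρ₁, h₁⟩ := hlip i τ hτ
  obtain ⟨ρ₂, hρ₂, h₂⟩ := Metric.uniformContinuous_iff.1
    (CompactSpace.uniformContinuous_of_continuous (hφ i)) τ hτ
  exact ⟨min ρ₁ ρ₂, lt_min hρ₁ hρ₂, fun x y hd => ⟨h₁ x y (hd.trans_le (min_le_left _ _)),
    (h₂ (hd.trans_le (min_le_right _ _))).le⟩⟩

set_option maxHeartbeats 1000000 in
/-- From a periodic orbit with a negative exponent one obtains another one whose exponent is still
negative but closer to zero by a definite factor, which visits a prescribed open set and whose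
orbit measure loses only a proportion of the first one comparable to its exponent. -/
theorem exists_periodic_orbit_with_smaller_exponent (hf : ∀ i, Continuous (f i))
    (hφ : ∀ i, Continuous (φ i))
    (hlip : ∀ i, ∀ τ > 0, ∃ ρ > 0, ∀ x y, dist x y < ρ →
      dist (f i x) (f i y) ≤ Real.exp (φ i x + τ) * dist x y)
    (hmin : ∀ x, ∀ V : Set X, IsOpen V → V.Nonempty → ∃ ω n, fibreMap f ω n x ∈ V)
    (hexp : ∀ x, ∃ ω n, 0 < fibreSum f φ ω n x) :
    ∃ C > 0, ∀ (p : (ℕ → Fin k) × X) (n : ℕ), 0 < n → Function.IsPeriodicPt (skewMap f) n p →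
      birkhoffSum (skewMap f) (fibreFun φ) n p < 0 →
      ∀ U : Set ((ℕ → Fin k) × X), IsOpen U → U.Nonempty → ∀ ε > 0,
      ∀ T : Finset C((ℕ → Fin k) × X, ℝ), (∀ ψ ∈ T, ∀ y, 0 ≤ ψ y ∧ ψ y ≤ 1) →
      ∃ (p' : (ℕ → Fin k) × X) (n' : ℕ), 0 < n' ∧ Function.IsPeriodicPt (skewMap f) n' p' ∧
        birkhoffSum (skewMap f) (fibreFun φ) n' p' < 0 ∧
        3 / 4 * birkhoffAverage ℝ (skewMap f) (fibreFun φ) n p ≤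
          birkhoffAverage ℝ (skewMap f) (fibreFun φ) n' p' ∧
        (∃ j, (skewMap f)^[j] p' ∈ U) ∧
        ∀ ψ ∈ T, (1 + C * birkhoffAverage ℝ (skewMap f) (fibreFun φ) n p) *
          birkhoffAverage ℝ (skewMap f) ψ n p - ε ≤ birkhoffAverage ℝ (skewMap f) ψ n' p' := by
  obtain ⟨a, ha, B, hB⟩ := exists_uniform_expansion hf hφ hexp
  obtain ⟨M, hM0, hM⟩ : ∃ M : ℝ, 0 ≤ M ∧ ∀ i x, |φ i x| ≤ M := by
    choose M hM using fun i => isCompact_univ.exists_bound_of_continuousOn (hφ i).continuousOn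
    refine ⟨∑ i, |M i|, by positivity, fun i x => ?_⟩
    exact ((hM i x (Set.mem_univ x)).trans (le_abs_self _)).trans
      (Finset.single_le_sum (f := fun i => |M i|) (fun i _ => abs_nonneg _) (Finset.mem_univ i))
  -- `κ` is the time needed per unit of expansion and `c₀` bounds the overshoot. The constant `C` is
  -- taken as `κ + 1`, which is certainly positive.
  set κ : ℝ := B / a with hκ
  have hκ0 : 0 ≤ κ := by positivity
  set c₀ : ℝ := B * M with hc₀
  have hc₀0 : 0 ≤ c₀ := by positivity
  refine ⟨κ + 1, by positivity, ?_⟩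
  rintro ⟨ω, x⟩ n hn hp hS U hU hUne ε hε T hT
  have hn' : (0 : ℝ) < n := by exact_mod_cast hn
  set Λ : ℝ := -birkhoffAverage ℝ (skewMap f) (fibreFun φ) n (ω, x) with hΛdef
  have hΛn : n * Λ = -birkhoffSum (skewMap f) (fibreFun φ) n (ω, x) := by
    rw [hΛdef, birkhoffAverage, smul_eq_mul]; field_simp
  have hΛ : 0 < Λ := by
    refine pos_of_mul_pos_right (a := (n : ℝ)) ?_ hn'.le
    linarith
  have havg : birkhoffAverage ℝ (skewMap f) (fibreFun φ) n (ω, x) = -Λ := by rw [hΛdef, neg_neg]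
  rw [havg]
  -- Distortion must be negligible against the contraction along the old orbit (first bound) and
  -- against the gain of the expanding word, which takes time about `κ` per unit (second bound).
  set τ : ℝ := min (Λ / 32) (1 / (32 * (κ + 1))) with hτdef
  have hτ : 0 < τ := by positivity
  have hτΛ : τ ≤ Λ / 32 := min_le_left _ _
  have hτκ : τ * κ ≤ 1 / 32 := by
    have : τ ≤ 1 / (32 * (κ + 1)) := min_le_right _ _
    calc τ * κ ≤ 1 / (32 * (κ + 1)) * (κ + 1) := by gcongr; linarith
      _ = 1 / 32 := by field_simp
  obtain ⟨ρ, hρ, hdist⟩ := exists_distortion_scale hφ hlip hτ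
  obtain ⟨m, ρ', hρ', hmod⟩ := exists_modulus T (half_pos hε)
  -- `K` will bound the logarithmic expansion, distortion included, at every intermediate time: the
  -- first entry accounts for an incomplete turn, the second for overshoot. Neither `K` nor `r`, and
  -- so neither `D` nor `R`, depends on `N`, which is chosen last.
  set K : ℝ := max (n * (M + 2 * τ)) (2 * c₀) with hK
  set r : ℝ := min ρ ρ' * Real.exp (-K) / 4 with hr
  have hr0 : 0 < r := by positivity
  have hrK : Real.exp K * (2 * r) < min ρ ρ' := by
    have h1 : Real.exp K * (2 * r) = min ρ ρ' / 2 := by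
      rw [hr, Real.exp_neg]; field_simp; ring
    have h2 : 0 < min ρ ρ' := lt_min hρ hρ'
    linarith
  obtain ⟨η, hη, D, hbridge⟩ := exists_uniform_bridge hf hmin
    (Metric.isOpen_ball (x := x) (ε := r / 2)) ⟨x, Metric.mem_ball_self (by positivity)⟩ hU hUne
  -- Contraction by `exp (-R)` brings the shadowing error below the margin of the visit to `U`, and
  -- `1 ≤ R` makes it at most `1 / 2`, as closing requires.
  obtain ⟨R, hR1, hRη⟩ : ∃ R : ℝ, 1 ≤ R ∧ Real.exp (-R) * r < η := by
    refine ⟨max 1 (r / η), le_max_left _ _, ?_⟩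
    have h1 := Real.add_one_le_exp (max 1 (r / η))
    have h2 : r / η < Real.exp (max 1 (r / η)) := by linarith [le_max_right 1 (r / η)]
    rw [Real.exp_neg, inv_mul_lt_iff₀ (Real.exp_pos _)]
    exact (div_lt_iff₀ hη).1 h2
  -- The three demands on `N`: the contraction left after the expanding word beats the bridge by
  -- `R`; the bridge changes the sum by at most `Q / 8`; and the time outside the old orbit that is
  -- not proportional to `Q`, together with the last `m` times, is absorbed by `ε`.
  obtain ⟨N, hN1, hNa, hNb, hNc⟩ := exists_nat_ge_three
    (4 * (2 * c₀ + D * (M + 2 * τ) + R) / (n * Λ)) (8 * (D * M) / (n * Λ))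
    ((m + (κ * c₀ + D)) / (ε / 2 * n))
  rw [div_le_iff₀ (by positivity)] at hNa hNb hNc
  have hN0 : (1 : ℝ) ≤ N := by exact_mod_cast hN1
  set Q : ℝ := N * (n * Λ) with hQ
  have hQ0 : 0 < Q := by positivity
  have hτN : τ * (N * n) ≤ Q / 32 := by
    calc τ * (N * n) ≤ Λ / 32 * (N * n) := by gcongr
      _ = Q / 32 := by rw [hQ]; ring
  -- Recovering half of the contraction `Q` leaves a sum near `-Q / 2`: strictly negative, yet with
  -- room below the factor `3 / 4`.
  obtain ⟨ν, l, hl1, hl2, hl3⟩ := exists_expanding_word ha hM hB (t := Q / 2) (by positivity) x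
  have hl : (l : ℝ) ≤ κ * (Q / 2 + c₀) := by
    rw [hκ, div_mul_eq_mul_div, le_div_iff₀ ha, mul_comm]
    exact hl3
  have hτl : τ * l ≤ Q / 64 + c₀ / 32 := by
    calc τ * l ≤ τ * (κ * (Q / 2 + c₀)) := by gcongr
      _ = τ * κ * (Q / 2 + c₀) := by ring
      _ ≤ 1 / 32 * (Q / 2 + c₀) := by gcongr
      _ = _ := by ring
  obtain ⟨δ, l', hl', hδV, jU, hjU, hδU⟩ := hbridge (fibreMap f ν l x)
  have hl'D : (l' : ℝ) ≤ D := by exact_mod_cast hl'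
  set W := glue ω (N * n) (glue ν l δ) with hW
  set len := N * n + (l + l') with hlen
  have hlenR : (len : ℝ) = N * n + (l + l') := by rw [hlen]; push_cast; ring
  have hlen0 : 0 < len := by have := Nat.mul_pos hN1 hn; omega
  have hlen0' : (0 : ℝ) < len := by exact_mod_cast hlen0
  have hmapN : fibreMap f ω (N * n) x = x := by
    have := (hp.const_mul N).eq
    exact congrArg Prod.snd this
  have hsumS : fibreSum f φ ω n x = -(n * Λ) := by rw [hΛn, neg_neg]; rfl
  have hsumN : fibreSum f φ ω (N * n) x = -Q := by
    have := birkhoffSum_mul_add_of_isPeriodicPt hp (fibreFun φ) N 0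
    simp only [add_zero, birkhoffSum_zero] at this
    rw [fibreSum, this]
    change N * fibreSum f φ ω n x = -Q
    rw [hsumS, hQ]; ring
  have hmapW : ∀ j, fibreMap f W (N * n + j) x = fibreMap f (glue ν l δ) j x := fun j => by
    rw [hW, fibreMap_glue_add, hmapN]
  have hsumW : ∀ j, fibreSum f φ W (N * n + j) x = -Q + fibreSum f φ (glue ν l δ) j x :=
    fun j => by rw [hW, fibreSum_glue_add, hmapN, hsumN]
  have hδsum : ∀ i ≤ l', |fibreSum f φ δ i (fibreMap f ν l x)| ≤ D * M := fun i hi =>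
    (abs_fibreSum_le f φ hM δ i _).trans (by
      have : (i : ℝ) ≤ D := by exact_mod_cast hi.trans hl'
      gcongr)
  -- Full turns contribute negatively even after distortion, so only the incomplete turn `j % n`
  -- matters.
  have phase₁ : ∀ j ≤ N * n, fibreSum f φ W j x + 2 * τ * j ≤ K := by
    intro j hj
    rw [hW, fibreSum_glue_of_le f φ hj]
    have h1 := birkhoffSum_mul_add_of_isPeriodicPt hp (fibreFun φ) (j / n) (j % n)
    rw [Nat.div_add_mod' j n] at h1
    change fibreSum f φ ω j x = _ * fibreSum f φ ω n x + fibreSum f φ ω (j % n) x at h1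
    have h2 := (abs_le.1 (abs_fibreSum_le f φ hM ω (j % n) x)).2
    have h3 : ((j % n : ℕ) : ℝ) ≤ n := by exact_mod_cast (Nat.mod_lt j hn).le
    have h4 : (j : ℝ) = (j / n : ℕ) * n + (j % n : ℕ) := by
      exact_mod_cast (Nat.div_add_mod' j n).symm
    have h5 : (0 : ℝ) ≤ (j / n : ℕ) := Nat.cast_nonneg _
    refine le_trans ?_ (le_max_left _ _)
    rw [h1, hsumS, h4]
    have h6 : ((j / n : ℕ) : ℝ) * (2 * τ * n - n * Λ) ≤ 0 := by
      refine mul_nonpos_of_nonneg_of_nonpos h5 ?_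
      have : τ * n ≤ Λ / 32 * n := by gcongr
      have : 0 < n * Λ := by positivity
      linarith
    have h7 : ((j % n : ℕ) : ℝ) * (M + 2 * τ) ≤ n * (M + 2 * τ) := by gcongr
    linarith
  have phase₂ : ∀ i ≤ l, fibreSum f φ W (N * n + i) x + 2 * τ * ((N * n + i : ℕ) : ℝ) ≤ K := by
    intro i hi
    rw [hsumW, fibreSum_glue_of_le f φ hi]
    have h1 := hl2 i hi
    have h2 : τ * i ≤ τ * l := by gcongr
    refine le_trans ?_ (le_max_right _ _)
    push_cast
    linarith
  have phase₃ : ∀ i ≤ l',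
      fibreSum f φ W (N * n + (l + i)) x + 2 * τ * ((N * n + (l + i) : ℕ) : ℝ) ≤ -R := by
    intro i hi
    rw [hsumW, fibreSum_glue_add]
    have h1 := hl2 l le_rfl
    have h2 := (abs_le.1 (hδsum i hi)).2
    have h3 : τ * i ≤ τ * D := by
      have : (i : ℝ) ≤ D := by exact_mod_cast hi.trans hl'
      gcongr
    push_cast
    linarith
  have hRK : -R ≤ K := by
    have : 2 * c₀ ≤ K := le_max_right _ _
    linarith
  have hphase : ∀ j ≤ len, fibreSum f φ W j x + 2 * τ * j ≤ K := by
    intro j hj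
    rcases le_total j (N * n) with h | h
    · exact phase₁ j h
    obtain ⟨i, rfl⟩ := Nat.exists_eq_add_of_le h
    rcases le_total i l with h' | h'
    · exact phase₂ i h'
    obtain ⟨i', rfl⟩ := Nat.exists_eq_add_of_le h'
    exact (phase₃ i' (by omega)).trans hRK
  obtain ⟨q, hq, hclose, hsumq⟩ := exists_fixedPoint_fibreMap (f := f) (φ := φ) (ω := W)
    (n := len) (x := x) hτ.le hr0 hdist
    (fun j hj => lt_of_le_of_lt (by gcongr; exact hphase j hj) (hrK.trans_le (min_le_left _ _)))
    (by
      refine (Real.exp_le_exp.2 ((phase₃ l' le_rfl).trans (neg_le_neg hR1))).trans ?_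
      rw [Real.exp_neg, one_div]
      exact inv_anti₀ two_pos (by linarith [Real.add_one_le_exp (1 : ℝ)]))
    (by
      rw [hlen, hmapW, fibreMap_glue_add]
      exact (Metric.mem_ball.1 hδV).le)
  have hWper : ∀ j, j < len → periodize W len j = W j := fun j hj => periodize_of_lt hj
  have hitq : ∀ j, j ≤ len → (skewMap f)^[j] (periodize W len, q) =
      ((fun i => periodize W len (i + j)), fibreMap f W j q) := fun j hj => by
    rw [skewMap_iterate]
    exact Prod.ext rfl (fibreMap_congr f (fun i hi => hWper i (hi.trans_le hj)) q)
  have hSW : fibreSum f φ W len x =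
      -Q + (fibreSum f φ ν l x + fibreSum f φ δ l' (fibreMap f ν l x)) := by
    rw [hlen, hsumW, fibreSum_glue_add]
  have hsumq' := abs_le.1 hsumq
  have hδl' := abs_le.1 (hδsum l' le_rfl)
  have hl2l := hl2 l le_rfl
  have hτlen : τ * len ≤ Q / 32 + (Q / 64 + c₀ / 32) + τ * D := by
    rw [hlenR]
    have : τ * l' ≤ τ * D := by gcongr
    linarith
  have hDτ : 0 ≤ D * τ := by positivity
  have hDM : 0 ≤ D * M := by positivity
  refine ⟨(periodize W len, q), len, hlen0, isPeriodicPt_periodize f hq, ?_, ?_, ?_, ?_⟩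
  · rw [birkhoffSum_periodize]
    linarith
  · rw [birkhoffAverage, birkhoffSum_periodize, smul_eq_mul, inv_mul_eq_div,
      le_div_iff₀ hlen0']
    -- The new period is at least `N * n`, so `Q / len ≤ Λ`.
    have h1 : Q ≤ len * Λ := by
      rw [hlenR, hQ]
      have : (0 : ℝ) ≤ (l + l') * Λ := by positivity
      linarith
    have h2 : τ * len ≤ Λ / 32 * len := by gcongr
    linarith
  · refine ⟨N * n + (l + jU), ?_⟩
    rw [hitq _ (by omega)]
    have h1 := hδU (fun i => periodize W len (i + (N * n + l))) (fun i hi => by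
      rw [hWper _ (by omega), hW, show i + (N * n + l) = (i + l) + N * n by ring, glue_add,
        glue_add]) (fibreMap f W (N * n + (l + jU)) q) (by
      have h2 := hclose (N * n + (l + jU)) (by omega)
      rw [hmapW, fibreMap_glue_add] at h2
      refine h2.trans_lt (lt_of_le_of_lt ?_ hRη)
      gcongr
      exact phase₃ jU hjU)
    convert h1 using 4
    ring
  · intro ψ hψ
    have hA0 : 0 ≤ birkhoffAverage ℝ (skewMap f) ψ n (ω, x) := by
      rw [birkhoffAverage, smul_eq_mul]
      exact mul_nonneg (by positivity) (Finset.sum_nonneg fun j _ => (hT ψ hψ _).1)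
    have hA1 : birkhoffAverage ℝ (skewMap f) ψ n (ω, x) ≤ 1 := by
      rw [birkhoffAverage, smul_eq_mul, inv_mul_le_iff₀ hn', birkhoffSum]
      refine (Finset.sum_le_card_nsmul _ _ 1 fun j _ => (hT ψ hψ _).2).trans ?_
      simp
    have hsum := sum_range_sub_le (a := fun j => ψ ((skewMap f)^[j] (ω, x)))
      (b := fun j => ψ ((skewMap f)^[j] (periodize W len, q))) (P := N * n) (L := len) (m := m)
      (ε := ε / 2) (by omega) (by positivity) (fun j => (hT ψ hψ _).2) (fun j => (hT ψ hψ _).1)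
      (fun j hj => by
        have h1 := hmod ψ hψ ((skewMap f)^[j] (ω, x)) ((skewMap f)^[j] (periodize W len, q))
          (fun i hi => by
            rw [hitq j (by omega), skewMap_iterate]
            dsimp only
            rw [hWper _ (by omega), hW, glue_of_lt (by omega)])
          (by
            rw [hitq j (by omega), skewMap_iterate]
            dsimp only
            have h2 := hclose j (by omega)
            rw [hW, fibreMap_glue_of_le f (by omega), ← hW] at h2
            refine lt_of_le_of_lt ?_ (hrK.trans_le (min_le_right _ _))
            refine h2.trans ?_
            have := hphase j (by omega)
            gcongr
            linarith)
        have := (abs_lt.1 h1).2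
        linarith)
    have hNsum := birkhoffSum_mul_add_of_isPeriodicPt hp ψ N 0
    simp only [add_zero, birkhoffSum_zero] at hNsum
    change birkhoffSum (skewMap f) ψ (N * n) (ω, x) - m - ε / 2 * (N * n : ℕ) ≤
      birkhoffSum (skewMap f) ψ len (periodize W len, q) at hsum
    have hAn : birkhoffSum (skewMap f) ψ n (ω, x) =
        n * birkhoffAverage ℝ (skewMap f) ψ n (ω, x) := by
      rw [birkhoffAverage, smul_eq_mul]; field_simp
    rw [hNsum, hAn] at hsum
    push_cast at hsum
    rw [birkhoffAverage.eq_1 ℝ (skewMap f) ψ len, smul_eq_mul, inv_mul_eq_div, le_div_iff₀ hlen0']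
    have := weighted_average_bound (P := N * n) (l := len) (Λ := Λ) (κ := κ) (c := κ * c₀ + D)
      (m := m) (ε := ε) (S := birkhoffSum (skewMap f) ψ len (periodize W len, q)) hA0 hA1 hΛ.le hκ0 (by positivity) (by positivity) hε.le
      (by rw [hlenR]; linarith [(l.cast_nonneg : (0 : ℝ) ≤ l), (l'.cast_nonneg : (0 : ℝ) ≤ l')])
      (by
        rw [hlenR]
        have h1 : 0 ≤ κ * Q := by positivity
        have h2 : κ * Λ * (N * n) = κ * Q := by rw [hQ]; ring
        linarith)
      (by linarith)
      (by linarith)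
    refine le_trans (le_of_eq ?_) this
    ring

end

/-! ### Averages along periodic orbits -/

section PeriodicOrbit

variable {Y : Type*} {F : Y → Y} {p : Y} {n : ℕ}

lemma birkhoffSum_apply_of_isPeriodicPt (hp : Function.IsPeriodicPt F n p) (g : Y → ℝ) :
    birkhoffSum F g n (F p) = birkhoffSum F g n p := by
  have := birkhoffSum_apply_sub_birkhoffSum F g n p
  rw [hp.eq, sub_self] at this
  exact sub_eq_zero.1 this

lemma birkhoffAverage_iterate_of_isPeriodicPt (hp : Function.IsPeriodicPt F n p) (g : Y → ℝ)
    (j : ℕ) : birkhoffAverage ℝ F g n (F^[j] p) = birkhoffAverage ℝ F g n p := by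
  induction j with
  | zero => rfl
  | succ j ih =>
    rw [Function.iterate_succ_apply', ← ih, birkhoffAverage, birkhoffAverage,
      birkhoffSum_apply_of_isPeriodicPt (hp.apply_iterate j)]

lemma birkhoffAverage_comp_of_isPeriodicPt (hp : Function.IsPeriodicPt F n p) (g : Y → ℝ) :
    birkhoffAverage ℝ F (g ∘ F) n p = birkhoffAverage ℝ F g n p := by
  rw [birkhoffAverage, birkhoffAverage, ← birkhoffSum_apply_of_isPeriodicPt hp g]
  congr 1
  refine Finset.sum_congr rfl fun j _ => ?_
  rw [Function.comp_apply, ← Function.iterate_succ_apply' F j p, Function.iterate_succ_apply]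

/-- The construction yields periods that need not be minimal, whereas orbit measures are normalized
by the minimal one. -/
lemma birkhoffAverage_minimalPeriod (hn : 0 < n) (hp : Function.IsPeriodicPt F n p) (g : Y → ℝ) :
    birkhoffAverage ℝ F g (Function.minimalPeriod F p) p = birkhoffAverage ℝ F g n p := by
  obtain ⟨N, hN⟩ := hp.minimalPeriod_dvd
  have h := birkhoffSum_mul_add_of_isPeriodicPt (Function.isPeriodicPt_minimalPeriod F p) g N 0
  simp only [add_zero, birkhoffSum_zero] at h
  rw [mul_comm, ← hN] at h
  have hm : (Function.minimalPeriod F p : ℝ) ≠ 0 := by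
    exact_mod_cast (hp.minimalPeriod_pos hn).ne'
  have hN0 : (N : ℝ) ≠ 0 := by
    rintro h0
    rw [Nat.cast_eq_zero.1 h0, mul_zero] at hN
    omega
  have hn' : (n : ℝ) = Function.minimalPeriod F p * N := by exact_mod_cast hN
  rw [birkhoffAverage, birkhoffAverage, h, hn', smul_eq_mul, smul_eq_mul]
  field_simp

variable [MeasurableSpace Y]

lemma isProbabilityMeasure_periodicOrbitMeasure (hp : p ∈ Function.periodicPts F) :
    IsProbabilityMeasure (periodicOrbitMeasure F p) := by
  refine ⟨?_⟩
  have h := Function.minimalPeriod_pos_of_mem_periodicPts hp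
  simp only [periodicOrbitMeasure, Measure.smul_apply, Measure.finsetSum_apply, measure_univ,
    Finset.sum_const, Finset.card_range, smul_eq_mul, nsmul_eq_mul, mul_one]
  exact ENNReal.inv_mul_cancel (by exact_mod_cast h.ne') (ENNReal.natCast_ne_top _)

lemma integral_periodicOrbitMeasure [TopologicalSpace Y] [OpensMeasurableSpace Y]
    (hn : 0 < n) (hp : Function.IsPeriodicPt F n p) {g : Y → ℝ} (hg : Continuous g) :
    ∫ y, g y ∂periodicOrbitMeasure F p = birkhoffAverage ℝ F g n p := by
  have hint : ∀ i ∈ Finset.range (Function.minimalPeriod F p),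
      Integrable g (Measure.dirac (F^[i] p)) := fun i _ =>
    integrable_dirac' hg.stronglyMeasurable (by simp)
  rw [← birkhoffAverage_minimalPeriod hn hp, periodicOrbitMeasure, integral_smul_measure,
    integral_finsetSum_measure hint, birkhoffAverage, birkhoffSum]
  congr 1
  · simp
  · exact Finset.sum_congr rfl fun i _ => integral_dirac' _ _ hg.stronglyMeasurable

end PeriodicOrbit

/-! ### Test functions -/

section TestFunctions

variable {Y : Type*} [TopologicalSpace Y]

/-- Truncation of a continuous function to values in the unit interval. -/
def unitClamp (h : C(Y, ℝ)) : C(Y, ℝ) where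
  toFun y := max 0 (min 1 (h y))
  continuous_toFun := by fun_prop

lemma unitClamp_mem (h : C(Y, ℝ)) (y : Y) : 0 ≤ unitClamp h y ∧ unitClamp h y ≤ 1 :=
  ⟨le_max_left _ _, max_le zero_le_one (min_le_left _ _)⟩

/-- Approximations of an indicator function may thus be truncated without loss. -/
lemma abs_sub_unitClamp_le (h : C(Y, ℝ)) (y : Y) {a : ℝ} (h0 : 0 ≤ a) (h1 : a ≤ 1) :
    |a - unitClamp h y| ≤ |a - h y| := by
  change |a - max 0 (min 1 (h y))| ≤ |a - h y|
  rcases le_total (h y) 0 with h2 | h2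
  · rw [min_eq_right (by linarith), max_eq_left h2, abs_of_nonneg (by linarith),
      abs_of_nonneg (by linarith)]
    linarith
  · rcases le_total (h y) 1 with h3 | h3
    · rw [min_eq_right h3, max_eq_right h2]
    · rw [min_eq_left h3, max_eq_right zero_le_one, abs_of_nonpos (by linarith),
        abs_of_nonpos (by linarith)]
      linarith

lemma continuous_birkhoffAverage {F : Y → Y} (hF : Continuous F) {g : Y → ℝ} (hg : Continuous g)
    (n : ℕ) : Continuous (birkhoffAverage ℝ F g n) := by
  have : birkhoffAverage ℝ F g n = fun y =>
      (n : ℝ)⁻¹ * ∑ i ∈ Finset.range n, g (F^[i] y) := rfl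
  rw [this]
  exact continuous_const.mul (continuous_finsetSum _ fun i _ => hg.comp (hF.iterate i))

lemma birkhoffAverage_mem_unit {Y : Type*} (F : Y → Y) {g : Y → ℝ} (hg : ∀ y, 0 ≤ g y ∧ g y ≤ 1)
    (n : ℕ) (y : Y) : 0 ≤ birkhoffAverage ℝ F g n y ∧ birkhoffAverage ℝ F g n y ≤ 1 := by
  rw [birkhoffAverage, birkhoffSum, smul_eq_mul]
  refine ⟨mul_nonneg (by positivity) (Finset.sum_nonneg fun i _ => (hg _).1), ?_⟩
  calc _ ≤ (n : ℝ)⁻¹ * (n : ℝ) := by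
        gcongr
        refine (Finset.sum_le_card_nsmul _ _ 1 fun j _ => (hg _).2).trans ?_
        simp
    _ ≤ 1 := inv_mul_le_one

/-- One minus the deviation of the time `n` average of `h` from the constant `c`. -/
noncomputable def concentration {F : Y → Y} (hF : Continuous F) (h : C(Y, ℝ)) (n : ℕ) (c : ℝ) :
    C(Y, ℝ) where
  toFun y := 1 - |birkhoffAverage ℝ F h n y - c|
  continuous_toFun := by
    have := continuous_birkhoffAverage hF h.continuous n
    fun_prop

lemma concentration_mem {F : Y → Y} (hF : Continuous F) {h : C(Y, ℝ)}
    (hh : ∀ y, 0 ≤ h y ∧ h y ≤ 1) (n : ℕ) {c : ℝ} (h0 : 0 ≤ c) (h1 : c ≤ 1) (y : Y) :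
    0 ≤ concentration hF h n c y ∧ concentration hF h n c y ≤ 1 := by
  change 0 ≤ 1 - |birkhoffAverage ℝ F h n y - c| ∧ 1 - |birkhoffAverage ℝ F h n y - c| ≤ 1
  obtain ⟨h2, h3⟩ := birkhoffAverage_mem_unit F hh n y
  refine ⟨?_, by linarith [abs_nonneg (birkhoffAverage ℝ F h n y - c)]⟩
  have : |birkhoffAverage ℝ F h n y - c| ≤ 1 := abs_le.2 ⟨by linarith, by linarith⟩
  linarith

/-- All windows of length `n` along an orbit of period `n` have the same average. -/
lemma birkhoffAverage_concentration {F : Y → Y} (hF : Continuous F) (h : C(Y, ℝ)) {n : ℕ} {p : Y}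
    (hn : 0 < n) (hp : Function.IsPeriodicPt F n p) :
    birkhoffAverage ℝ F (concentration hF h n (birkhoffAverage ℝ F h n p)) n p = 1 := by
  have : ∀ j, concentration hF h n (birkhoffAverage ℝ F h n p) (F^[j] p) = 1 := fun j => by
    change 1 - |birkhoffAverage ℝ F h n (F^[j] p) - _| = 1
    rw [birkhoffAverage_iterate_of_isPeriodicPt hp, sub_self, abs_zero, sub_zero]
  have hn' : (n : ℝ) ≠ 0 := by exact_mod_cast hn.ne'
  rw [birkhoffAverage, birkhoffSum, Finset.sum_congr rfl fun j _ => this j]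
  simp [hn']

lemma birkhoffAverage_pos_of_visit {Y : Type*} {F : Y → Y} {g : Y → ℝ} (hg : ∀ y, 0 ≤ g y) {n : ℕ}
    {p : Y} (hn : 0 < n) (hp : Function.IsPeriodicPt F n p) {j : ℕ} (hj : 0 < g (F^[j] p)) :
    0 < birkhoffAverage ℝ F g n p := by
  rw [birkhoffAverage, smul_eq_mul, birkhoffSum]
  have hn' : (0 : ℝ) < n := by exact_mod_cast hn
  refine mul_pos (by positivity) (Finset.sum_pos' (fun i _ => hg _)
    ⟨j % n, Finset.mem_range.2 (Nat.mod_lt j hn), ?_⟩)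
  rwa [hp.iterate_mod_apply]

end TestFunctions

/-! ### Sequences of periodic orbits -/

section Sequence

variable {Y : Type*}

/-- A point with a period along which the sum of `φ` is negative. -/
def IsNegativeOrbit (F : Y → Y) (φ : Y → ℝ) (s : Y × ℕ) : Prop :=
  0 < s.2 ∧ Function.IsPeriodicPt F s.2 s.1 ∧ birkhoffSum F φ s.2 s.1 < 0

lemma IsNegativeOrbit.mean_neg {F : Y → Y} {φ : Y → ℝ} {s : Y × ℕ} (h : IsNegativeOrbit F φ s) :
    birkhoffAverage ℝ F φ s.2 s.1 < 0 := by
  rw [birkhoffAverage, smul_eq_mul]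
  have : (0 : ℝ) < s.2 := by exact_mod_cast h.1
  exact mul_neg_of_pos_of_neg (by positivity) h.2.2

variable [TopologicalSpace Y]

/-- Every periodic orbit with a negative mean of `φ` can be modified so that the mean decreases in
absolute value by a definite factor, at a cost proportional to this mean. -/
def HasCheapImprovement (F : Y → Y) (φ : Y → ℝ) (C : ℝ) : Prop :=
  ∀ s, IsNegativeOrbit F φ s → ∀ U : Set Y, IsOpen U → U.Nonempty → ∀ ε > 0,
    ∀ T : Finset C(Y, ℝ), (∀ ψ ∈ T, ∀ y, 0 ≤ ψ y ∧ ψ y ≤ 1) →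
    ∃ s', IsNegativeOrbit F φ s' ∧
      3 / 4 * birkhoffAverage ℝ F φ s.2 s.1 ≤ birkhoffAverage ℝ F φ s'.2 s'.1 ∧
      (∃ j, F^[j] s'.1 ∈ U) ∧
      ∀ ψ ∈ T, (1 + C * birkhoffAverage ℝ F φ s.2 s.1) * birkhoffAverage ℝ F ψ s.2 s.1 - ε ≤
        birkhoffAverage ℝ F ψ s'.2 s'.1

/-- A lower bound for the mean of a test function that persists under cheap improvements. -/
def PersistentBound (F : Y → Y) (φ : Y → ℝ) (C : ℝ) (s : Y × ℕ) (t : C(Y, ℝ) × ℝ) : Prop :=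
  (∀ y, 0 ≤ t.1 y ∧ t.1 y ≤ 1) ∧ 0 ≤ t.2 ∧
    t.2 * (1 - 8 * C * birkhoffAverage ℝ F φ s.2 s.1) < birkhoffAverage ℝ F t.1 s.2 s.1

variable {F : Y → Y} {φ : Y → ℝ} {C : ℝ}

lemma PersistentBound.le (hC : 0 < C) {s : Y × ℕ} (h : IsNegativeOrbit F φ s)
    {t : C(Y, ℝ) × ℝ} (ht : PersistentBound F φ C s t) :
    t.2 ≤ birkhoffAverage ℝ F t.1 s.2 s.1 := by
  have h1 := ht.2.2
  have h2 : 0 ≤ t.2 * (C * -birkhoffAverage ℝ F φ s.2 s.1) :=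
    mul_nonneg ht.2.1 (mul_nonneg hC.le (by linarith [h.mean_neg]))
  linarith

/-- With `u = -C * e`, where `e` is the old mean, one has `(1 - u) * (1 + 8 * u) ≥ 1 + 6 * u` when
`8 * u ≤ 1`, and `6 = 8 * (3 / 4)` is the slack required for the new mean. Strictness leaves room
for `ε`. -/
lemma HasCheapImprovement.exists_persistent (hC : 0 < C) (H : HasCheapImprovement F φ C)
    {s : Y × ℕ} (hs : IsNegativeOrbit F φ s)
    (hsmall : -(8 * C * birkhoffAverage ℝ F φ s.2 s.1) ≤ 1) {U : Set Y} (hU : IsOpen U)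
    (hUne : U.Nonempty) {T : Finset (C(Y, ℝ) × ℝ)} (hT : ∀ t ∈ T, PersistentBound F φ C s t) :
    ∃ s', IsNegativeOrbit F φ s' ∧
      3 / 4 * birkhoffAverage ℝ F φ s.2 s.1 ≤ birkhoffAverage ℝ F φ s'.2 s'.1 ∧
      (∃ j, F^[j] s'.1 ∈ U) ∧ ∀ t ∈ T, PersistentBound F φ C s' t := by
  classical
  set e := birkhoffAverage ℝ F φ s.2 s.1 with he
  have he0 : e < 0 := hs.mean_neg
  have gap : ∀ t ∈ T, 0 < (1 + C * e) * birkhoffAverage ℝ F t.1 s.2 s.1 -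
      t.2 * (1 - 6 * C * e) := by
    intro t ht
    obtain ⟨-, h0, h1⟩ := hT t ht
    have h2 : 0 < 1 + C * e := by linarith
    have h3 := mul_lt_mul_of_pos_left h1 h2
    have hCe : 0 < C * -e := mul_pos hC (by linarith)
    have h4 : 0 ≤ (C * -e) * (1 - 8 * (C * -e)) := mul_nonneg hCe.le (by linarith)
    have h5 : 0 ≤ t.2 * ((C * -e) * (1 - 8 * (C * -e))) := mul_nonneg h0 h4
    linarith
  obtain ⟨ε, hε, hε0⟩ : ∃ ε : ℝ, (∀ t ∈ T, ε < (1 + C * e) * birkhoffAverage ℝ F t.1 s.2 s.1 -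
      t.2 * (1 - 6 * C * e)) ∧ 0 < ε := by
    have h1 : ∀ᶠ ε in 𝓝[>] (0 : ℝ), ∀ t ∈ T,
        ε < (1 + C * e) * birkhoffAverage ℝ F t.1 s.2 s.1 - t.2 * (1 - 6 * C * e) :=
      (eventually_all_finset T).2 fun t ht => by
        filter_upwards [Ioo_mem_nhdsGT (gap t ht)] with ε hε using hε.2
    exact (h1.and self_mem_nhdsWithin).exists
  obtain ⟨s', hs', h1, h2, h3⟩ := H s hs U hU hUne ε hε0 (T.image Prod.fst) (fun ψ hψ => by
    obtain ⟨t, ht, rfl⟩ := Finset.mem_image.1 hψ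
    exact (hT t ht).1)
  refine ⟨s', hs', h1, h2, fun t ht => ⟨(hT t ht).1, (hT t ht).2.1, ?_⟩⟩
  have h4 := h3 t.1 (Finset.mem_image_of_mem _ ht)
  have h5 := hε t ht
  have h6 : 0 ≤ t.2 * (C * (birkhoffAverage ℝ F φ s'.2 s'.1 - 3 / 4 * e)) :=
    mul_nonneg (hT t ht).2.1 (mul_nonneg hC.le (by linarith))
  linarith

lemma HasCheapImprovement.exists_mean_small [Nonempty Y] (H : HasCheapImprovement F φ C)
    {s : Y × ℕ} (hs : IsNegativeOrbit F φ s) {ε : ℝ} (hε : 0 < ε) :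
    ∃ s', IsNegativeOrbit F φ s' ∧ -ε ≤ birkhoffAverage ℝ F φ s'.2 s'.1 := by
  have h : ∀ N : ℕ, ∃ s', IsNegativeOrbit F φ s' ∧
      (3 / 4) ^ N * birkhoffAverage ℝ F φ s.2 s.1 ≤ birkhoffAverage ℝ F φ s'.2 s'.1 := by
    intro N
    induction N with
    | zero => exact ⟨s, hs, by simp⟩
    | succ N ih =>
      obtain ⟨s', hs', h1⟩ := ih
      obtain ⟨s'', hs'', h2, -⟩ := H s' hs' Set.univ isOpen_univ Set.univ_nonempty 1 one_pos ∅
        (by simp)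
      exact ⟨s'', hs'', by rw [pow_succ]; linarith⟩
  have hlim : Tendsto (fun N : ℕ => (3 / 4 : ℝ) ^ N * birkhoffAverage ℝ F φ s.2 s.1) atTop
      (𝓝 0) := by
    simpa using (tendsto_pow_atTop_nhds_zero_of_lt_one (by norm_num : (0 : ℝ) ≤ 3 / 4)
      (by norm_num)).mul_const (birkhoffAverage ℝ F φ s.2 s.1)
  obtain ⟨N, hN⟩ := (hlim.eventually (lt_mem_nhds (neg_lt_zero.2 hε))).exists
  obtain ⟨s', hs', h1⟩ := h N
  exact ⟨s', hs', hN.le.trans h1⟩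

/-- The states of the inductive construction: a periodic orbit of small negative mean, with a
finite list of persistent bounds. -/
def IsAdmissibleState (F : Y → Y) (φ : Y → ℝ) (C : ℝ) (σ : (Y × ℕ) × Finset (C(Y, ℝ) × ℝ)) :
    Prop :=
  IsNegativeOrbit F φ σ.1 ∧ -(8 * C * birkhoffAverage ℝ F φ σ.1.2 σ.1.1) ≤ 1 ∧
    -1 ≤ birkhoffAverage ℝ F φ σ.1.2 σ.1.1 ∧ ∀ t ∈ σ.2, PersistentBound F φ C σ.1 t

/-- The lower bound imposed on concentration functions along the construction. -/
noncomputable def concentrationBound (C e : ℝ) : ℝ := (1 + e) / (1 - 8 * C * e)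

lemma IsAdmissibleState.exists_next (hF : Continuous F) (hC : 0 < C)
    (H : HasCheapImprovement F φ C) (g h : ℕ → C(Y, ℝ)) (hg : ∀ i y, 0 ≤ g i y ∧ g i y ≤ 1)
    (hh : ∀ i y, 0 ≤ h i y ∧ h i y ≤ 1) (m : ℕ) {σ : (Y × ℕ) × Finset (C(Y, ℝ) × ℝ)}
    (hσ : IsAdmissibleState F φ C σ) :
    ∃ σ', IsAdmissibleState F φ C σ' ∧
      3 / 4 * birkhoffAverage ℝ F φ σ.1.2 σ.1.1 ≤ birkhoffAverage ℝ F φ σ'.1.2 σ'.1.1 ∧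
      σ.2 ⊆ σ'.2 ∧ ((∃ y, 0 < g m y) → ∃ c > 0, (g m, c) ∈ σ'.2) ∧
      ∀ j ≤ m, (concentration hF (h j) σ'.1.2 (birkhoffAverage ℝ F (h j) σ'.1.2 σ'.1.1),
        concentrationBound C (birkhoffAverage ℝ F φ σ'.1.2 σ'.1.1)) ∈ σ'.2 := by
  classical
  obtain ⟨h1, h2, h3, h4⟩ := hσ
  set U : Set Y := if ∃ y, 0 < g m y then {y | 0 < g m y} else Set.univ with hU
  have hUo : IsOpen U := by
    rw [hU]; split_ifs
    · exact isOpen_lt continuous_const (g m).continuous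
    · exact isOpen_univ
  have hUne : U.Nonempty := by
    rw [hU]; split_ifs with hy
    · exact hy
    · exact ⟨σ.1.1, trivial⟩
  obtain ⟨s', hs', a1, ⟨j, a2⟩, a3⟩ := H.exists_persistent hC h1 h2 hUo hUne h4
  set e := birkhoffAverage ℝ F φ s'.2 s'.1 with he
  have he0 : e < 0 := hs'.mean_neg
  have hle : birkhoffAverage ℝ F φ σ.1.2 σ.1.1 ≤ e := by linarith [h1.mean_neg]
  have hCe : 0 < C * -e := mul_pos hC (by linarith)
  have hden : 0 < 1 - 8 * C * e := by linarith
  have hsmall : -(8 * C * e) ≤ 1 := by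
    have : C * birkhoffAverage ℝ F φ σ.1.2 σ.1.1 ≤ C * e := by gcongr
    linarith
  -- Dividing by twice the slack factor makes the new bound hold strictly at the current orbit.
  set S₁ : Finset (C(Y, ℝ) × ℝ) := if ∃ y, 0 < g m y then
    {(g m, birkhoffAverage ℝ F (g m) s'.2 s'.1 / (2 * (1 - 8 * C * e)))} else ∅ with hS₁
  set S₂ : Finset (C(Y, ℝ) × ℝ) := (Finset.range (m + 1)).image fun j =>
    (concentration hF (h j) s'.2 (birkhoffAverage ℝ F (h j) s'.2 s'.1),
      concentrationBound C e) with hS₂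
  have hpos : (∃ y, 0 < g m y) → 0 < birkhoffAverage ℝ F (g m) s'.2 s'.1 := fun hy => by
    rw [hU, if_pos hy] at a2
    exact birkhoffAverage_pos_of_visit (fun y => (hg m y).1) hs'.1 hs'.2.1 a2
  refine ⟨(s', σ.2 ∪ (S₁ ∪ S₂)), ⟨hs', hsmall, h3.trans hle, fun t ht => ?_⟩, a1,
    Finset.subset_union_left, fun hy => ?_, fun j hj => ?_⟩
  · simp only [Finset.mem_union] at ht
    rcases ht with ht | ht | ht
    · exact a3 t ht
    · rw [hS₁] at ht
      split_ifs at ht with hy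
      · obtain rfl := Finset.mem_singleton.1 ht
        have hA := hpos hy
        refine ⟨hg m, by positivity, ?_⟩
        change birkhoffAverage ℝ F (g m) s'.2 s'.1 / (2 * (1 - 8 * C * e)) * (1 - 8 * C * e) <
          birkhoffAverage ℝ F (g m) s'.2 s'.1
        rw [div_mul_eq_mul_div, mul_div_mul_right _ _ hden.ne']
        linarith
      · simp at ht
    · obtain ⟨j, -, rfl⟩ := Finset.mem_image.1 ht
      obtain ⟨b1, b2⟩ := birkhoffAverage_mem_unit F (hh j) s'.2 s'.1
      refine ⟨concentration_mem hF (hh j) _ b1 b2,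
        div_nonneg (by linarith) hden.le, ?_⟩
      -- The mean is exactly `1`, and `1 + e < 1` since `e < 0`.
      change (1 + e) / (1 - 8 * C * e) * (1 - 8 * C * e) < birkhoffAverage ℝ F _ s'.2 s'.1
      rw [div_mul_cancel₀ _ hden.ne', birkhoffAverage_concentration hF (h j) hs'.1 hs'.2.1]
      linarith
  · have hA := hpos hy
    refine ⟨birkhoffAverage ℝ F (g m) s'.2 s'.1 / (2 * (1 - 8 * C * e)), by positivity, ?_⟩
    simp [hS₁, if_pos hy]
  · refine Finset.mem_union_right _ (Finset.mem_union_right _ ?_)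
    exact Finset.mem_image.2 ⟨j, Finset.mem_range.2 (Nat.lt_succ_of_le hj), rfl⟩

/-- A sequence of periodic orbits whose means of `φ` tend to zero, along which given nonnegative
test functions keep a positive mean, and the time averages of given test functions concentrate. -/
theorem HasCheapImprovement.exists_sequence (hF : Continuous F) (hC : 0 < C)
    (H : HasCheapImprovement F φ C) {s₀ : Y × ℕ} (hs₀ : IsNegativeOrbit F φ s₀)
    (g h : ℕ → C(Y, ℝ)) (hg : ∀ i y, 0 ≤ g i y ∧ g i y ≤ 1)
    (hh : ∀ i y, 0 ≤ h i y ∧ h i y ≤ 1) :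
    ∃ s : ℕ → Y × ℕ, (∀ m, IsNegativeOrbit F φ (s m)) ∧
      Tendsto (fun m => birkhoffAverage ℝ F φ (s m).2 (s m).1) atTop (𝓝 0) ∧
      (∀ i, (∃ y, 0 < g i y) → ∃ c > 0, ∀ᶠ m in atTop,
        c ≤ birkhoffAverage ℝ F (g i) (s m).2 (s m).1) ∧
      ∀ j, ∀ ε > 0, ∃ n c, 0 < n ∧ ∀ᶠ m in atTop,
        1 - ε ≤ birkhoffAverage ℝ F (concentration hF (h j) n c) (s m).2 (s m).1 := by
  have : Nonempty Y := ⟨s₀.1⟩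
  obtain ⟨s₁, hs₁, hsmall⟩ := H.exists_mean_small hs₀ (ε := min 1 (1 / (8 * C))) (by positivity)
  have hσ₀ : IsAdmissibleState F φ C (s₁, ∅) := by
    refine ⟨hs₁, ?_, ?_, by simp⟩
    · have h1 : -birkhoffAverage ℝ F φ s₁.2 s₁.1 ≤ 1 / (8 * C) := by
        linarith [min_le_right 1 (1 / (8 * C))]
      rw [le_div_iff₀ (by positivity)] at h1
      change -(8 * C * birkhoffAverage ℝ F φ s₁.2 s₁.1) ≤ 1
      linarith
    · change -1 ≤ birkhoffAverage ℝ F φ s₁.2 s₁.1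
      linarith [min_le_left 1 (1 / (8 * C))]
  choose next hnext using fun (m : ℕ) (σ : {σ // IsAdmissibleState F φ C σ}) =>
    σ.2.exists_next hF hC H g h hg hh m
  let S : ℕ → {σ // IsAdmissibleState F φ C σ} := fun m =>
    Nat.rec ⟨_, hσ₀⟩ (fun m σ => ⟨next m σ, (hnext m σ).1⟩) m
  have hS : ∀ m, (S (m + 1)).1 = next m (S m) := fun m => rfl
  have hmono : Monotone fun m => (S m).1.2 := monotone_nat_of_le_succ fun m => by
    rw [hS]; exact (hnext m (S m)).2.2.1
  have hneg : ∀ m, IsNegativeOrbit F φ (S m).1.1 := fun m => (S m).2.1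
  have hlow : ∀ m, (3 / 4) ^ m * birkhoffAverage ℝ F φ s₁.2 s₁.1 ≤
      birkhoffAverage ℝ F φ (S m).1.1.2 (S m).1.1.1 := by
    intro m
    induction m with
    | zero => simp [S]
    | succ m ih =>
      have := (hnext m (S m)).2.1
      rw [← hS] at this
      rw [pow_succ]
      linarith
  have hlim : Tendsto (fun m => birkhoffAverage ℝ F φ (S m).1.1.2 (S m).1.1.1) atTop (𝓝 0) := by
    refine tendsto_of_tendsto_of_tendsto_of_le_of_le ?_ tendsto_const_nhds hlow
      fun m => (hneg m).mean_neg.le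
    simpa using (tendsto_pow_atTop_nhds_zero_of_lt_one (by norm_num : (0 : ℝ) ≤ 3 / 4)
      (by norm_num)).mul_const (birkhoffAverage ℝ F φ s₁.2 s₁.1)
  have hpersist : ∀ m t, t ∈ (S m).1.2 → ∀ m' ≥ m,
      t.2 ≤ birkhoffAverage ℝ F t.1 (S m').1.1.2 (S m').1.1.1 := fun m t ht m' hm =>
    ((S m').2.2.2.2 t (hmono hm ht)).le hC (hneg m')
  refine ⟨fun m => (S m).1.1, hneg, hlim, fun i hi => ?_, fun j ε hε => ?_⟩
  · obtain ⟨c, hc, hmem⟩ := (hnext i (S i)).2.2.2.1 hi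
    rw [← hS] at hmem
    exact ⟨c, hc, eventually_atTop.2 ⟨i + 1, fun m' hm' => hpersist (i + 1) (g i, c) hmem m' hm'⟩⟩
  · have hb : Tendsto (fun m => concentrationBound C
        (birkhoffAverage ℝ F φ (S m).1.1.2 (S m).1.1.1)) atTop (𝓝 1) := by
      have h1 : ContinuousAt (concentrationBound C) 0 := by
        unfold concentrationBound
        exact ContinuousAt.div (by fun_prop) (by fun_prop) (by simp)
      have h2 := h1.tendsto.comp hlim
      have h3 : concentrationBound C 0 = 1 := by simp [concentrationBound]
      rwa [h3] at h2
    -- The shift by one is there because step `m` records the concentration bounds of orbit `m + 1`.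
    obtain ⟨m, hm, hjm⟩ := (((tendsto_add_atTop_iff_nat 1).2 hb).eventually
      (lt_mem_nhds (by linarith : 1 - ε < 1))).and (eventually_ge_atTop j) |>.exists
    have hmem := (hnext m (S m)).2.2.2.2 j hjm
    rw [← hS] at hmem
    exact ⟨_, _, (hneg (m + 1)).1,
      eventually_atTop.2 ⟨m + 1, fun m' hm' => hm.le.trans (hpersist _ _ hmem m' hm')⟩⟩

end Sequence

/-! ### The limit measure -/

section Limit

variable {Y : Type*} [MeasurableSpace Y]

/-- Any `c` is at distance at least `1 / 2` from one of the values `0` and `1`; Markov's inequality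
bounds the set where that value is taken. -/
lemma measureReal_le_of_indicator_near_const {μ : Measure Y} [IsProbabilityMeasure μ] {s : Set Y}
    (hs : MeasurableSet s) {c ε : ℝ} (h : ∫ y, |s.indicator (fun _ => (1 : ℝ)) y - c| ∂μ ≤ ε) :
    μ.real s ≤ 2 * ε ∨ μ.real sᶜ ≤ 2 * ε := by
  have hint : ∀ t : Set Y, MeasurableSet t → Integrable (t.indicator fun _ => (1 : ℝ)) μ :=
    fun t ht => (integrable_const 1).indicator ht
  have hI : Integrable (fun y => |s.indicator (fun _ => (1 : ℝ)) y - c|) μ :=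
    ((hint s hs).sub (integrable_const c)).abs
  have key : ∀ t : Set Y, MeasurableSet t →
      (∀ y ∈ t, 1 / 2 ≤ |s.indicator (fun _ => (1 : ℝ)) y - c|) →
      μ.real t ≤ 2 * ε := by
    intro t ht hle
    have h1 : ∫ y, 1 / 2 * t.indicator (fun _ => (1 : ℝ)) y ∂μ ≤
        ∫ y, |s.indicator (fun _ => (1 : ℝ)) y - c| ∂μ := by
      refine integral_mono ((hint t ht).const_mul _) hI fun y => ?_
      by_cases hy : y ∈ t
      · simpa [hy] using hle y hy
      · simp [hy]
    rw [integral_const_mul, integral_indicator_const _ ht] at h1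
    simp only [smul_eq_mul, mul_one] at h1
    linarith
  rcases le_total c (1 / 2) with hc | hc
  · refine Or.inl (key s hs fun y hy => ?_)
    rw [Set.indicator_of_mem hy]
    exact le_trans (by linarith) (le_abs_self _)
  · refine Or.inr (key sᶜ hs.compl fun y hy => ?_)
    rw [Set.indicator_of_notMem hy]
    exact le_trans (by linarith) (neg_le_abs _)

variable [TopologicalSpace Y] [BorelSpace Y]

lemma integrable_of_continuous_of_compactSpace [CompactSpace Y] {μ : Measure Y} [IsFiniteMeasure μ]
    {g : Y → ℝ} (hg : Continuous g) : Integrable g μ :=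
  (BoundedContinuousFunction.mkOfCompact ⟨g, hg⟩).integrable μ

lemma tendsto_integral_of_compactSpace [CompactSpace Y] {ν : ℕ → ProbabilityMeasure Y}
    {μ : ProbabilityMeasure Y} (h : Tendsto ν atTop (𝓝 μ)) {g : Y → ℝ} (hg : Continuous g) :
    Tendsto (fun m => ∫ y, g y ∂(ν m : Measure Y)) atTop (𝓝 (∫ y, g y ∂(μ : Measure Y))) :=
  ProbabilityMeasure.tendsto_iff_forall_integral_tendsto.1 h
    (BoundedContinuousFunction.mkOfCompact ⟨g, hg⟩)

lemma measurePreserving_of_integral_comp [CompactSpace Y] [HasOuterApproxClosed Y] {F : Y → Y}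
    (hF : Continuous F) {μ : Measure Y} [IsProbabilityMeasure μ]
    (h : ∀ g : C(Y, ℝ), ∫ y, g (F y) ∂μ = ∫ y, g y ∂μ) : MeasurePreserving F μ μ := by
  refine ⟨hF.measurable, ?_⟩
  have : IsProbabilityMeasure (μ.map F) := Measure.isProbabilityMeasure_map hF.aemeasurable
  refine ext_of_forall_integral_eq_of_IsFiniteMeasure fun g => ?_
  rw [integral_map hF.aemeasurable g.continuous.aestronglyMeasurable]
  exact h g.toContinuousMap

/-- Averaging does not increase the `L¹` distance to an invariant function. -/
lemma integral_abs_sub_birkhoffAverage_le [CompactSpace Y] {F : Y → Y} (hF : Continuous F)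
    {μ : Measure Y} [IsProbabilityMeasure μ] (hμ : MeasurePreserving F μ μ) {u : Y → ℝ}
    (hu : Integrable u μ) (hinv : ∀ y, u (F y) = u y) (h : C(Y, ℝ)) {n : ℕ} (hn : 0 < n) :
    ∫ y, |u y - birkhoffAverage ℝ F h n y| ∂μ ≤ ∫ y, |u y - h y| ∂μ := by
  have hn' : (0 : ℝ) < n := by exact_mod_cast hn
  have hinv' : ∀ i y, u (F^[i] y) = u y := fun i y => by
    induction i with
    | zero => rfl
    | succ i ih => rw [Function.iterate_succ_apply', hinv, ih]
  have hh : Integrable h μ := integrable_of_continuous_of_compactSpace h.continuous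
  have hd : Integrable (fun y => |u y - h y|) μ := (hu.sub hh).abs
  have hdi : ∀ i, Integrable (fun y => |u (F^[i] y) - h (F^[i] y)|) μ := fun i =>
    (hμ.iterate i).integrable_comp_of_integrable hd
  have hint : ∀ i, ∫ y, |u (F^[i] y) - h (F^[i] y)| ∂μ = ∫ y, |u y - h y| ∂μ := fun i => by
    have := (integral_map (μ := μ) (φ := F^[i]) (f := fun y => |u y - h y|)
      (hF.iterate i).aemeasurable (by
        rw [(hμ.iterate i).map_eq]; exact hd.aestronglyMeasurable)).symm
    rwa [(hμ.iterate i).map_eq] at this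
  have hpt : ∀ y, |u y - birkhoffAverage ℝ F h n y| ≤
      (n : ℝ)⁻¹ * ∑ i ∈ Finset.range n, |u (F^[i] y) - h (F^[i] y)| := fun y => by
    have h1 : u y - birkhoffAverage ℝ F h n y =
        (n : ℝ)⁻¹ * ∑ i ∈ Finset.range n, (u (F^[i] y) - h (F^[i] y)) := by
      rw [Finset.sum_sub_distrib, birkhoffAverage, birkhoffSum, smul_eq_mul,
        Finset.sum_congr rfl fun i _ => hinv' i y]
      simp only [Finset.sum_const, Finset.card_range, nsmul_eq_mul]
      field_simp
    rw [h1, abs_mul, abs_of_pos (inv_pos.2 hn')]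
    gcongr
    exact Finset.abs_sum_le_sum_abs _ _
  calc ∫ y, |u y - birkhoffAverage ℝ F h n y| ∂μ
      ≤ ∫ y, (n : ℝ)⁻¹ * ∑ i ∈ Finset.range n, |u (F^[i] y) - h (F^[i] y)| ∂μ := by
        refine integral_mono ?_ ?_ hpt
        · exact (hu.sub (integrable_of_continuous_of_compactSpace
            (continuous_birkhoffAverage hF h.continuous n))).abs
        · exact (integrable_finsetSum _ fun i _ => hdi i).const_mul _
    _ = ∫ y, |u y - h y| ∂μ := by
        rw [integral_const_mul, integral_finsetSum _ fun i _ => hdi i]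
        simp only [hint, Finset.sum_const, Finset.card_range, nsmul_eq_mul]
        field_simp

/-- An invariant measure is ergodic if the time averages of a dense family of test functions are,
at suitable times, close to constants in mean. -/
lemma ergodic_of_concentration [CompactSpace Y] [TopologicalSpace.MetrizableSpace Y] {F : Y → Y}
    (hF : Continuous F) {μ : Measure Y} [IsProbabilityMeasure μ] (hμ : MeasurePreserving F μ μ)
    {h : ℕ → C(Y, ℝ)} (hd : DenseRange h)
    (hc : ∀ j, ∀ ε > 0, ∃ n c, 0 < n ∧ 1 - ε ≤ ∫ y, concentration hF (unitClamp (h j)) n c y ∂μ) :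
    Ergodic F μ := by
  refine ⟨hμ, ⟨fun s hs hinv => ?_⟩⟩
  have hu : Integrable (s.indicator fun _ => (1 : ℝ)) μ := (integrable_const 1).indicator hs
  have hsF : ∀ y, s.indicator (fun _ => (1 : ℝ)) (F y) = s.indicator (fun _ => (1 : ℝ)) y := by
    intro y
    have : F y ∈ s ↔ y ∈ s := by rw [← Set.mem_preimage, hinv]
    by_cases hy : y ∈ s
    · rw [Set.indicator_of_mem hy, Set.indicator_of_mem (this.2 hy)]
    · rw [Set.indicator_of_notMem hy, Set.indicator_of_notMem (fun h => hy (this.1 h))]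
  have hmain : ∀ ε > 0, μ.real s ≤ ε ∨ μ.real sᶜ ≤ ε := by
    intro ε hε
    obtain ⟨g, hg, hgi⟩ := hu.exists_boundedContinuous_integral_sub_le (ε := ε / 6) (by positivity)
    obtain ⟨j, hj⟩ := hd.exists_dist_lt g.toContinuousMap (ε := ε / 6) (by positivity)
    obtain ⟨n, c, hn, hnc⟩ := hc j (ε / 6) (by positivity)
    set ψ := unitClamp (h j) with hψ
    have hA : Continuous (birkhoffAverage ℝ F ψ n) :=
      continuous_birkhoffAverage hF ψ.continuous n
    have hAi : Integrable (birkhoffAverage ℝ F ψ n) μ := integrable_of_continuous_of_compactSpace hA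
    have i1 : Integrable (fun y => ‖s.indicator (fun _ => (1 : ℝ)) y - g y‖) μ := (hu.sub hgi).norm
    have i2 : Integrable (fun y => |birkhoffAverage ℝ F ψ n y - c|) μ :=
      (hAi.sub (integrable_const c)).abs
    have i3 : Integrable
        (fun y => |s.indicator (fun _ => (1 : ℝ)) y - birkhoffAverage ℝ F ψ n y|) μ :=
      (hu.sub hAi).abs
    have h1 : ∫ y, |s.indicator (fun _ => (1 : ℝ)) y - ψ y| ∂μ ≤ ε / 6 + ε / 6 := by
      calc _ ≤ ∫ y, (‖s.indicator (fun _ => (1 : ℝ)) y - g y‖ + ε / 6) ∂μ := by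
            refine integral_mono (hu.sub
              (integrable_of_continuous_of_compactSpace ψ.continuous)).abs
              (i1.add (integrable_const _)) fun y => ?_
            have h2 := abs_sub_unitClamp_le (h j) y (a := s.indicator (fun _ => (1 : ℝ)) y)
              (Set.indicator_nonneg (fun _ _ => zero_le_one) y)
              (Set.indicator_le_self' (fun _ _ => zero_le_one) y)
            have h3 := (ContinuousMap.dist_apply_le_dist (f := g.toContinuousMap) (g := h j) y).trans
              hj.le
            rw [Real.dist_eq] at h3
            exact h2.trans ((abs_sub_le _ (g y) _).trans (by
              rw [Real.norm_eq_abs]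
              exact add_le_add_right h3 _))
        _ ≤ ε / 6 + ε / 6 := by
            rw [integral_add i1 (integrable_const _)]
            simpa using hg
    have h2 := (integral_abs_sub_birkhoffAverage_le hF hμ hu hsF ψ hn).trans h1
    have h3 : ∫ y, |birkhoffAverage ℝ F ψ n y - c| ∂μ ≤ ε / 6 := by
      have h4 : ∫ y, concentration hF ψ n c y ∂μ =
          ∫ y, (1 - |birkhoffAverage ℝ F ψ n y - c|) ∂μ := rfl
      rw [h4, integral_sub (integrable_const _) i2] at hnc
      simp only [integral_const, probReal_univ, smul_eq_mul, mul_one] at hnc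
      linarith
    have h5 : ∫ y, |s.indicator (fun _ => (1 : ℝ)) y - c| ∂μ ≤ ε / 2 := by
      calc _ ≤ ∫ y, (|s.indicator (fun _ => (1 : ℝ)) y - birkhoffAverage ℝ F ψ n y| +
            |birkhoffAverage ℝ F ψ n y - c|) ∂μ :=
            integral_mono (hu.sub (integrable_const c)).abs
              (i3.add i2)
              fun y => abs_sub_le _ _ _
        _ ≤ ε / 2 := by
            rw [integral_add i3 i2]
            linarith
    have := measureReal_le_of_indicator_near_const hs h5
    rwa [mul_div_cancel₀ _ (two_ne_zero' ℝ)] at this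
  rw [eventuallyConst_set']
  by_cases h0 : μ.real s = 0
  · left
    exact ae_eq_empty.2 ((measureReal_eq_zero_iff).1 h0)
  · right
    refine ae_eq_univ.2 ((measureReal_eq_zero_iff).1 ?_)
    by_contra h1
    have p0 : 0 < μ.real s := measureReal_nonneg.lt_of_ne' h0
    have p1 : 0 < μ.real sᶜ := measureReal_nonneg.lt_of_ne' h1
    rcases hmain (min (μ.real s) (μ.real sᶜ) / 2) (by positivity) with h | h
    · linarith [min_le_left (μ.real s) (μ.real sᶜ)]
    · linarith [min_le_right (μ.real s) (μ.real sᶜ)]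

/-- Truncations of a dense family of functions detect all open sets. -/
lemma isOpenPosMeasure_of_dense {Y : Type*} [MeasurableSpace Y] [TopologicalSpace Y] [CompactSpace Y] [TopologicalSpace.MetrizableSpace Y] {μ : Measure Y}
    [IsProbabilityMeasure μ] {h : ℕ → C(Y, ℝ)} (hd : DenseRange h)
    (hpos : ∀ i, (∃ y, 0 < unitClamp (h i - ContinuousMap.const Y (1 / 4)) y) →
      0 < ∫ y, unitClamp (h i - ContinuousMap.const Y (1 / 4)) y ∂μ) : μ.IsOpenPosMeasure := by
  refine ⟨fun U hU ⟨x, hx⟩ h0 => ?_⟩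
  -- A function within `1 / 4` of this `u`, lowered by `1 / 4`, is nonpositive off `U` and at least
  -- `1 / 2` at `x`.
  obtain ⟨u, hu0, hu1, -⟩ := exists_continuous_zero_one_of_isClosed hU.isClosed_compl
    (isClosed_singleton (x := x)) (Set.disjoint_singleton_right.2 (fun hc => hc hx))
  obtain ⟨i, hi⟩ := hd.exists_dist_lt u (ε := 1 / 4) (by norm_num)
  have hclose : ∀ y, |u y - h i y| ≤ 1 / 4 := fun y => by
    have := (ContinuousMap.dist_apply_le_dist (f := u) (g := h i) y).trans hi.le
    rwa [Real.dist_eq] at this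
  have hval : ∀ y, unitClamp (h i - ContinuousMap.const Y (1 / 4)) y =
      max 0 (min 1 (h i y - 1 / 4)) := fun y => rfl
  have hx0 : 0 < unitClamp (h i - ContinuousMap.const Y (1 / 4)) x := by
    rw [hval]
    have h1 := (abs_le.1 (hclose x)).2
    have h2 : u x = 1 := hu1 rfl
    exact lt_max_of_lt_right (lt_min one_pos (by linarith))
  refine (hpos i ⟨x, hx0⟩).ne' ?_
  refine integral_eq_zero_of_ae ?_
  have hUae : ∀ᵐ y ∂μ, y ∉ U := measure_eq_zero_iff_ae_notMem.1 h0
  filter_upwards [hUae] with y hy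
  rw [hval]
  have h1 := (abs_le.1 (hclose y)).1
  have h2 : u y = 0 := hu0 hy
  exact max_eq_left ((min_le_right _ _).trans (by linarith))

theorem HasCheapImprovement.exists_ergodic [CompactSpace Y] [TopologicalSpace.MetrizableSpace Y]
    [SecondCountableTopology Y] {F : Y → Y} {φ : Y → ℝ} {C : ℝ} (hF : Continuous F)
    (hφ : Continuous φ) (hC : 0 < C) (H : HasCheapImprovement F φ C) {s₀ : Y × ℕ}
    (hs₀ : IsNegativeOrbit F φ s₀) :
    ∃ μ : ProbabilityMeasure Y, Ergodic F (μ : Measure Y) ∧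
      (μ : Measure Y).IsOpenPosMeasure ∧
      (∃ ν : ℕ → ProbabilityMeasure Y,
        (∀ n, ∃ p ∈ Function.periodicPts F, (ν n : Measure Y) = periodicOrbitMeasure F p) ∧
        Tendsto ν atTop (𝓝 μ)) ∧
      ∫ y, φ y ∂(μ : Measure Y) = 0 := by
  let h : ℕ → C(Y, ℝ) := TopologicalSpace.denseSeq C(Y, ℝ)
  have hd : DenseRange h := TopologicalSpace.denseRange_denseSeq _
  obtain ⟨s, hs, hlim, hg, hh⟩ := H.exists_sequence hF hC hs₀
    (fun i => unitClamp (h i - ContinuousMap.const Y (1 / 4))) (fun i => unitClamp (h i))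
    (fun i => unitClamp_mem _) (fun i => unitClamp_mem _)
  have hper : ∀ m, (s m).1 ∈ Function.periodicPts F := fun m => ⟨(s m).2, (hs m).1, (hs m).2.1⟩
  let ν₀ : ℕ → ProbabilityMeasure Y := fun m =>
    ⟨periodicOrbitMeasure F (s m).1, isProbabilityMeasure_periodicOrbitMeasure (hper m)⟩
  obtain ⟨μ, κ, hκ, hμ⟩ := CompactSpace.tendsto_subseq ν₀
  have hint : ∀ {g : Y → ℝ}, Continuous g → ∀ m, ∫ y, g y ∂(ν₀ m : Measure Y) =
      birkhoffAverage ℝ F g (s m).2 (s m).1 := fun hg m =>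
    integral_periodicOrbitMeasure (hs m).1 (hs m).2.1 hg
  have hconv : ∀ {g : Y → ℝ}, Continuous g → Tendsto
      (fun m => birkhoffAverage ℝ F g (s (κ m)).2 (s (κ m)).1) atTop
      (𝓝 (∫ y, g y ∂(μ : Measure Y))) := fun {g} hg => by
    have := tendsto_integral_of_compactSpace hμ hg
    refine this.congr fun m => ?_
    exact hint hg (κ m)
  have hmp : MeasurePreserving F (μ : Measure Y) μ :=
    measurePreserving_of_integral_comp hF fun g => by
      have h1 := hconv (g := g ∘ F) (g.continuous.comp hF)
      refine tendsto_nhds_unique h1 ((hconv g.continuous).congr fun m => ?_)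
      exact (birkhoffAverage_comp_of_isPeriodicPt (hs _).2.1 g).symm
  refine ⟨μ, ergodic_of_concentration hF hmp hd fun j ε hε => ?_,
    isOpenPosMeasure_of_dense hd fun i hi => ?_,
    ⟨ν₀ ∘ κ, fun n => ⟨_, hper (κ n), rfl⟩, hμ⟩,
    tendsto_nhds_unique (hconv hφ) (hlim.comp hκ.tendsto_atTop)⟩
  · obtain ⟨n, c, hn, hev⟩ := hh j ε hε
    exact ⟨n, c, hn, ge_of_tendsto (hconv (ContinuousMap.continuous _))
      (hκ.tendsto_atTop.eventually hev)⟩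
  · obtain ⟨c, hc, hev⟩ := hg i hi
    exact hc.trans_le (ge_of_tendsto (hconv (ContinuousMap.continuous _))
      (hκ.tendsto_atTop.eventually hev))

end Limit

/-! ### Families of circle diffeomorphisms -/

section Circle

variable {k : ℕ} (f : Fin k → CircleDiffeo)

/-- The composition of the family along a word, as a circle diffeomorphism. -/
lemma exists_diffeo_eq_fibreMap (ω : ℕ → Fin k) (n : ℕ) :
    ∃ g : CircleDiffeo, (⇑g : Circle → Circle) = fibreMap (fun i => f i) ω n ∧
      ∀ x, circleAbsDeriv g x = Real.exp (fibreSum (fun i => f i)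
        (fun i x => Real.log (circleAbsDeriv (f i) x)) ω n x) := by
  induction n with
  | zero =>
    refine ⟨Diffeomorph.refl _ _ _, rfl, fun x => ?_⟩
    rw [fibreSum_zero, Real.exp_zero]
    exact circleAbsDeriv_id x
  | succ n ih =>
    obtain ⟨g, hg, hD⟩ := ih
    refine ⟨g.trans (f (ω n)), ?_, fun x => ?_⟩
    · funext x
      rw [fibreMap_succ, ← hg]
      rfl
    · rw [Diffeomorph.coe_trans, CircleDiffeo.absDeriv_comp, hD, fibreSum_succ, Real.exp_add,
        Real.exp_log ((f (ω n)).absDeriv_pos _), hg, mul_comm]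

lemma circleAbsDeriv_fibreMap (ω : ℕ → Fin k) (n : ℕ) (x : Circle) :
    circleAbsDeriv (fibreMap (fun i => f i) ω n) x = Real.exp (fibreSum (fun i => f i)
      (fun i x => Real.log (circleAbsDeriv (f i) x)) ω n x) := by
  obtain ⟨g, hg, hD⟩ := exists_diffeo_eq_fibreMap f ω n
  rw [← hg, hD]

lemma exists_fibreMap_of_mem_iteratedSemigroup {g : Circle → Circle}
    (hg : g ∈ iteratedSemigroup f) :
    ∃ ω n, 0 < n ∧ g = fibreMap (fun i => f i) ω n := by
  induction hg using Subsemigroup.closure_induction with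
  | mem g hg =>
    obtain ⟨i, rfl⟩ := hg
    exact ⟨fun _ => i, 1, one_pos, rfl⟩
  | mul g h _ _ ihg ihh =>
    obtain ⟨ω, n, hn, rfl⟩ := ihg
    obtain ⟨ω', n', hn', rfl⟩ := ihh
    -- In the product `g * h` the factor `h` acts first, so its word comes first.
    refine ⟨glue ω' n' ω, n' + n, by omega, ?_⟩
    funext x
    rw [fibreMap_glue_add]
    rfl

lemma iterate_mem_iteratedSemigroup {g : Circle → Circle} (hg : g ∈ iteratedSemigroup f) {n : ℕ}
    (hn : 0 < n) : g^[n] ∈ iteratedSemigroup f := by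
  induction n, hn using Nat.le_induction with
  | base => exact hg
  | succ n _ ih =>
    rw [Function.iterate_succ]
    exact (iteratedSemigroup f).mul_mem ih hg

end Circle

theorem theoremB (k : ℕ) (hk : 2 ≤ k) (f : Fin k → CircleDiffeo)
    (hmin : IsMinimalFamily f)
    (hexp : IsBackwardExpanding f)
    (hatt : ∃ g : Circle → Circle, g ∈ iteratedSemigroup f ∧
      HasHyperbolicAttractingPeriodicPt g) :
    ∃ μ : ProbabilityMeasure (SkewSpace k),
      Ergodic (skewProduct f) (μ : Measure (SkewSpace k)) ∧
      (μ : Measure (SkewSpace k)).support = Set.univ ∧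
      (∃ ν : ℕ → ProbabilityMeasure (SkewSpace k),
        (∀ n, ∃ p ∈ Function.periodicPts (skewProduct f),
          (ν n : Measure (SkewSpace k)) = periodicOrbitMeasure (skewProduct f) p) ∧
        Tendsto ν atTop (𝓝 μ)) ∧
      Integrable (fibreLogDeriv f) (μ : Measure (SkewSpace k)) ∧
      fibreLyapunovExponent f (μ : Measure (SkewSpace k)) = 0 := by
  set L : Fin k → Circle → ℝ := fun i x => Real.log (circleAbsDeriv (f i) x) with hL
  have hLc : ∀ i, Continuous (L i) := fun i => (f i).continuous_log_absDeriv
  have hfc : ∀ i, Continuous (f i) := fun i => (f i).continuous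
  have hφ : Continuous (fibreLogDeriv f) := continuous_fibreFun hLc
  have hF : Continuous (skewProduct f) := continuous_skewMap hfc
  obtain ⟨C, hC, hstep⟩ := exists_periodic_orbit_with_smaller_exponent (f := fun i => f i) hfc hLc
    (fun i => (f i).local_lipschitz)
    (fun x V hV hVne => by
      obtain ⟨y, hyV, g, hg, hgx⟩ := (hmin x).inter_open_nonempty V hV hVne
      obtain ⟨ω, n, -, rfl⟩ := exists_fibreMap_of_mem_iteratedSemigroup f hg
      exact ⟨ω, n, hgx ▸ hyV⟩)
    (fun x => by
      obtain ⟨g, hg, hgx⟩ := hexp x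
      obtain ⟨ω, n, -, rfl⟩ := exists_fibreMap_of_mem_iteratedSemigroup f hg
      rw [circleAbsDeriv_fibreMap, Real.one_lt_exp_iff] at hgx
      exact ⟨ω, n, hgx⟩)
  have H : HasCheapImprovement (skewProduct f) (fibreLogDeriv f) C := by
    intro s hs U hU hUne ε hε T hT
    obtain ⟨p', n', h1, h2, h3, h4, h5, h6⟩ := hstep s.1 s.2 hs.1 hs.2.1 hs.2.2 U hU hUne ε hε T hT
    exact ⟨(p', n'), ⟨h1, h2, h3⟩, h4, h5, h6⟩
  obtain ⟨g, hg, x, m, hm, hper, hder⟩ := hatt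
  -- The iterate `g^[m]` is again given by a word, and it fixes `x` with derivative below `1`;
  -- repeating that word gives the initial negative orbit.
  obtain ⟨ω, n, hn, hgn⟩ :=
    exists_fibreMap_of_mem_iteratedSemigroup f (iterate_mem_iteratedSemigroup f hg hm)
  rw [hgn, circleAbsDeriv_fibreMap, Real.exp_lt_one_iff] at hder
  have hfix : fibreMap (fun i => f i) ω n x = x := by rw [← hgn]; exact hper
  have hs₀ : IsNegativeOrbit (skewProduct f) (fibreLogDeriv f) ((periodize ω n, x), n) := by
    refine ⟨hn, isPeriodicPt_periodize _ hfix, ?_⟩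
    exact (birkhoffSum_periodize (fun i => f i) L).trans_lt hder
  obtain ⟨μ, hμ, hpos, hν, hzero⟩ := H.exists_ergodic hF hφ hC hs₀
  exact ⟨μ, hμ, Measure.support_eq_univ, hν, integrable_of_continuous_of_compactSpace hφ, hzero⟩
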